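/- Let $h_1>2c>0$. For a continuous $w:[0,\infty)\to\mathbb R$ let $\mathcal H(w)(s)=h_1$ if $w<0$ on $[0,s]$, and $\mathcal H(w)(s)=0$ otherwise. We say that $w$ switches at the moment $s\ge 0$ if $w(s)=0$ and $w<0$ on $[0,s)$. Write $\Delta u_k=u_{k+1}-2u_k+u_{k-1}$ and $\nabla u_k=u_{k+1}-u_k$. Solutions of lattice equations are understood to be continuous in time, to satisfy the equation with right derivatives, and to satisfy $|u_k(s)|\le A e^{\alpha|k|}$ on every bounded time interval, with $A,\alpha$ depending on the interval. Let $u=(u_k)_{k\in\mathbb Z}$ be a solution of $$\dot u_k=\Delta u_k+\mathcal H(u_k),\quad t>0,\qquad u_k(0)=-ck^2,\qquad k\in\mathbb Z .$$ Let $a>0$ be a root, for $\rho=h_1/c$, of $$-1+(\rho-2)a-\rho\int_{-1}^{1}Y\bigl(1-x,\,a(1-x^2)\bigr)\,dx=0,\qquad Y(x,t)=\int_0^t\frac{e^{-x^2/(4s)}}{\sqrt{4\pi s}}\,ds ,$$ and let $E>0$. Then there is $n_0=n_0(E,h_1,c)$ such that the following holds for every $n\ge n_0+1$ and all real $t_0,\dots,t_n$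 with $|t_k-ak^2|\le E\sqrt k$ for $0\le k\le n$. (i) Assume (inductive hypothesis) that $u_k$ switches at the moment $t_k$ for $k=0,\dots,n-1$ and that $u_j<0$ on $[0,t_{n-1}]$ for all $j\ge n$. Let $v$ be a solution of the problem with frozen hysteresis, $$\dot v_k=\Delta v_k+\mathcal H(u_k)(t_{n-1}),\quad t>t_{n-1},\qquad v_k(t_{n-1})=u_k(t_{n-1}),\qquad k\in\mathbb Z,$$ and assume that $v_n(t_n)=0$. Then $\nabla v_j(t)<0$ for all $t\in(t_{n-1},t_n]$ and all $j\ge n$. Consequently $v_j(t)<0$ for all $t\in(t_{n-1},t_n]$ and all $j\ge n+1$, and none of the nodes $u_{n+1},u_{n+2},\dots$ switches on $[0,t_n]$. (ii) The same $n_0$ works whether or not the moments come from the hysteresis operator: if $w$ is a solution of $\dot w_k=\Delta w_k+f_k(t)$, $t>0$, $w_k(0)=-ck^2$, $k\in\mathbb Z$, where $f_k(t)=0$ if $|k|<n$ and $t\ge t_{|k|}$, and $f_k(t)=h_1$ otherwise, and if $w_{n-1}(t_{n-1})=0$ and $w_n(t_n)=0$, then $\nabla w_j(t)<0$ for all $t\in(t_{n-1},t_n]$,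 $j\ge n$, and $w_j(t)<0$ for all $t\in(t_{n-1},t_n]$, $j\ge n+1$. -/

import Mathlib

open Set

noncomputable section

namespace Rattling

/-- The second difference `u_{k+1} - 2 u_k + u_{k-1}` at time `s`. -/
def lap (u : ℤ → ℝ → ℝ) (k : ℤ) (s : ℝ) : ℝ :=
  u (k + 1) s - 2 * u k s + u (k - 1) s

/-- The forward spatial difference `∇ u_k = u_{k+1} - u_k` at time `s`. -/
def grad (u : ℤ → ℝ → ℝ) (k : ℤ) (s : ℝ) : ℝ :=
  u (k + 1) s - u k s

open Classical in
/-- The bistable switch with thresholds `-∞` and `0` and values `h₁` and `0`: the output is `h₁` as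
long as the input has been negative on the whole time interval `[0, s]`; it becomes `0` as soon as
the input reaches the threshold `0`, and it stays `0` afterwards. -/
def hysteresis (h₁ : ℝ) (w : ℝ → ℝ) (s : ℝ) : ℝ :=
  if ∀ r ∈ Icc 0 s, w r < 0 then h₁ else 0

/-- `s` is the switching moment of the input `w`: the first moment at which `w` is at the
threshold `0`. -/
def IsSwitchingMoment (w : ℝ → ℝ) (s : ℝ) : Prop :=
  0 ≤ s ∧ w s = 0 ∧ ∀ r ∈ Ico 0 s, w r < 0

/-- `u` solves `du_k/ds = Δ u_k + f_k` for all `k : ℤ` on `[t₀, ∞)`. As usual on an infinite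
lattice, solutions grow at most exponentially in `k`, uniformly on bounded time intervals. The
right-hand side jumps at switching moments, where `f` is right-continuous, so each continuous
function `u_k` is required to have the stated right derivative at every time. -/
structure IsLatticeSolution (f : ℤ → ℝ → ℝ) (t₀ : ℝ) (u : ℤ → ℝ → ℝ) : Prop where
  continuousOn : ∀ k, ContinuousOn (u k) (Ici t₀)
  growth : ∀ T, ∃ A α : ℝ, ∀ k : ℤ, ∀ s ∈ Icc t₀ T, |u k s| ≤ A * Real.exp (α * |(k : ℝ)|)
  deriv : ∀ k, ∀ s, t₀ ≤ s → HasDerivWithinAt (u k) (lap u k s + f k s) (Ici s) s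

/-- `u` solves `du_k/dt = Δ u_k + H(u_k)`, `u_k(0) = -c k²`, on `[0, ∞)`. -/
def IsHysteresisSolution (h₁ c : ℝ) (u : ℤ → ℝ → ℝ) : Prop :=
  IsLatticeSolution (fun k s => hysteresis h₁ (u k) s) 0 u ∧ ∀ k : ℤ, u k 0 = -c * (k : ℝ) ^ 2

/-- `v` solves the problem with the hysteresis configuration of `u` frozen at time `t₀`:
`dv_k/dt = Δ v_k + H_k` for `t > t₀`, with `v_k(t₀) = u_k(t₀)` and `H_k = H(u_k)(t₀)`. -/
def IsFrozenSolution (h₁ : ℝ) (u : ℤ → ℝ → ℝ) (t₀ : ℝ) (v : ℤ → ℝ → ℝ) : Prop :=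
  IsLatticeSolution (fun k _ => hysteresis h₁ (u k) t₀) t₀ v ∧ ∀ k : ℤ, v k t₀ = u k t₀

/-- The right-hand side in which the nodes `k` with `|k| < n` are switched from `h₁` to `0` at the
given moments `t_{|k|}`, and all the other nodes keep the value `h₁`. -/
def prescribedOutput (h₁ : ℝ) (t : ℕ → ℝ) (n : ℕ) (k : ℤ) (s : ℝ) : ℝ :=
  if k.natAbs < n ∧ t k.natAbs ≤ s then 0 else h₁

/-- The solution of `Y_t = Y_xx + δ₀`, `Y(x, 0) = 0`, that is
`Y(x, t) = ∫₀ᵗ (4πs)^{-1/2} exp(-x² / (4s)) ds`. -/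
def green (x t : ℝ) : ℝ :=
  ∫ s in (0 : ℝ)..t, Real.exp (-x ^ 2 / (4 * s)) / Real.sqrt (4 * Real.pi * s)

/-- The coefficient of `c n²` in the asymptotic expansion of `v_n(a n²)` when the nodes
`k = -n + 1, …, n - 1` switch at the moments `a k²`, as a function of `ρ = h₁ / c` and `a`. -/
def leadingCoeff (ρ a : ℝ) : ℝ :=
  -1 + (ρ - 2) * a - ρ * ∫ x in (-1 : ℝ)..1, green (1 - x) (a * (1 - x ^ 2))

end Rattling

end

/-!
For prescribed switching moments the lattice equation is linear and its solution `model` is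
explicit: it is `-c k² + (h₁ - 2c) s` minus `h₁` times a superposition of lattice Green functions
`latticeGreen`, one for each node that has been switched off (`isLatticeSolution_model`). By the
maximum principle on the lattice, solutions of exponential growth are unique, so the functions of
the theorem are all equal to `model` on the relevant time intervals. For the hysteresis problem this
uses that its solution is unique and hence even in `k` (`IsHysteresisSolution.unique`,
`IsHysteresisSolution.even`); a comparison of `u` with the frozen solution, whose right-hand side is
larger, then excludes further switchings.

The slope of `model` ahead of the front is `-c (2j + 1)` plus `h₁` times a sum of the tails
`latticeTail`, which increase in time and decrease in space. It is therefore largest at the front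
`j = n` and at the time `t n`. There the lattice tails agree with Gaussian tails up to `O(1/s)`,
uniformly in space, by a comparison of Fourier integrals (`exists_latticeTail_le`). As the moments
lie within `E √k` of the parabola `a k²`, the sum is a left Riemann sum of the increasing function
`tailProfile` up to an error that tends to zero, so the slope is at most
`-c (2n + 1) + h₁ n ∫ tailProfile + o(1)`. An explicit primitive gives
`∫ green = a - (1/2 + a) ∫ tailProfile` (`integral_green_parabola`), by which the root condition
turns into `h₁ ∫ tailProfile = 2c`. The terms of order `n` cancel, and the slope is at most `-c/2`
(`eventually_grad_model_le`).

In view of this slope, negativity ahead of the front follows once the front value is at most `c/4`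
on the whole interval `[t (n - 1), t n]`. The front value is at most `0` at the left end, by the
slope at the previous front, and it is `0` at the right end. In between it is a convex function
minus `h₁` times the response to the node switched last. Convexity holds because the recently
switched nodes contribute second derivatives of a favourable sign that dominate the others
(`eventually_sum_lap_heatKer_nonpos`), and the response to the last node is almost above its chord
over long time intervals (`exists_chord_le_latticeGreen_one`).
-/

namespace Rattling

open Filter Topology

/-! ### The maximum principle on the lattice -/

theorem eventually_neg_of_hasDerivWithinAt {F : ℝ → ℝ} {d x : ℝ}
    (h : HasDerivWithinAt F d (Ici x) x) (hd : d < 0) (h0 : F x = 0) :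
    ∀ᶠ s in 𝓝[>] x, F s < 0 := by
  have h1 : Tendsto (slope F x) (𝓝[>] x) (𝓝 d) :=
    (hasDerivWithinAt_iff_tendsto_slope' (by simp)).1 (h.mono Ioi_subset_Ici_self)
  filter_upwards [h1.eventually_lt_const hd, self_mem_nhdsWithin] with s hs hxs
  rw [slope_def_field, h0, sub_zero] at hs
  have hpos : 0 < s - x := sub_pos.2 hxs
  by_contra! hc
  exact absurd (div_nonneg hc hpos.le) (not_le.2 hs)

theorem lap_cosh (γ : ℝ) (g : ℝ → ℝ) (k : ℤ) (s : ℝ) :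
    lap (fun k s => g s * Real.cosh (γ * (k : ℝ))) k s =
      (2 * Real.cosh γ - 2) * (g s * Real.cosh (γ * (k : ℝ))) := by
  simp only [lap, Int.cast_add, Int.cast_sub, Int.cast_one, mul_add, mul_sub, mul_one,
    Real.cosh_add, Real.cosh_sub]
  ring

/-- Maximum principle for the lattice heat equation. The differential inequality is required only
where `z k s > 0`, so the statement also covers boundary value problems on subsets of `ℤ`:
extend the function by `0`. -/
theorem lattice_max_principle {T₀ T₁ : ℝ} {z : ℤ → ℝ → ℝ}
    (hcont : ∀ k, ContinuousOn (z k) (Icc T₀ T₁))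
    (hgrow : ∃ A α : ℝ, ∀ k : ℤ, ∀ s ∈ Icc T₀ T₁, z k s ≤ A * Real.exp (α * |(k : ℝ)|))
    (h0 : ∀ k, z k T₀ ≤ 0)
    (hd : ∀ k, ∀ s ∈ Ico T₀ T₁, 0 < z k s →
      ∃ d, HasDerivWithinAt (z k) d (Ici s) s ∧ d ≤ lap z k s) :
    ∀ k, ∀ s ∈ Icc T₀ T₁, z k s ≤ 0 := by
  obtain ⟨A, α, hA⟩ := hgrow
  -- The barrier `ψ k s = exp (β (s - T₀)) cosh (γ k)` outgrows `z` in space because `γ > |α|`, and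
  -- it is a strict supersolution because `β > 2 cosh γ - 2`.
  set γ : ℝ := |α| + 1 with hγ
  set β : ℝ := 2 * Real.cosh γ - 1 with hβ
  set g : ℝ → ℝ := fun s => Real.exp (β * (s - T₀)) with hg
  set ψ : ℤ → ℝ → ℝ := fun k s => g s * Real.cosh (γ * (k : ℝ)) with hψ
  have hcosh : 1 ≤ Real.cosh γ := Real.one_le_cosh γ
  have hψpos : ∀ k s, 0 < ψ k s := fun k s =>
    mul_pos (Real.exp_pos _) (Real.cosh_pos _)
  have hψd : ∀ k s, HasDerivAt (ψ k) (β * ψ k s) s := by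
    intro k s
    have h1 : HasDerivAt g (Real.exp (β * (s - T₀)) * (β * 1)) s :=
      (((hasDerivAt_id s).sub_const T₀).const_mul β).exp
    refine (h1.mul_const (Real.cosh (γ * (k : ℝ)))).congr_deriv ?_
    simp only [hψ, hg]; ring
  have key : ∀ ε > 0, ∀ s ∈ Icc T₀ T₁, ∀ k, z k s ≤ ε * ψ k s := by
    intro ε hε
    obtain ⟨N, hN⟩ := exists_nat_ge (2 * |A| / ε)
    -- Outside a finite set of nodes the growth condition alone gives the bound.
    have hfar : ∀ k : ℤ, k ∉ Finset.Icc (-(N : ℤ)) N → ∀ s ∈ Icc T₀ T₁, z k s ≤ ε * ψ k s := by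
      intro k hk s hs
      have hk' : (N : ℝ) ≤ |(k : ℝ)| := by
        have : (N : ℤ) ≤ |k| := by
          by_contra! hlt
          exact hk (Finset.mem_Icc.2 (abs_le.1 hlt.le))
        exact_mod_cast this
      have h1 : 2 * |A| ≤ ε * Real.exp |(k : ℝ)| := by
        have h2 := Real.add_one_le_exp |(k : ℝ)|
        have h3 : 2 * |A| / ε ≤ Real.exp |(k : ℝ)| := by linarith
        rwa [div_le_iff₀' hε] at h3
      have h4 : Real.exp (γ * |(k : ℝ)|) ≤ 2 * Real.cosh (γ * (k : ℝ)) := by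
        have h5 : Real.cosh (γ * (k : ℝ)) = Real.cosh (γ * |(k : ℝ)|) := by
          rcases abs_cases (k : ℝ) with ⟨h, _⟩ | ⟨h, _⟩ <;> rw [h]
          rw [mul_neg, Real.cosh_neg]
        rw [h5, Real.cosh_eq]
        have := Real.exp_pos (-(γ * |(k : ℝ)|))
        linarith
      have h6 : 1 ≤ g s := by
        apply Real.one_le_exp
        apply mul_nonneg <;> linarith [hs.1]
      calc z k s ≤ A * Real.exp (α * |(k : ℝ)|) := hA k s hs
        _ ≤ |A| * Real.exp (|α| * |(k : ℝ)|) := by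
          gcongr
          · exact le_abs_self A
          · exact le_abs_self α
        _ ≤ (ε * Real.exp |(k : ℝ)| / 2) * Real.exp (|α| * |(k : ℝ)|) := by
          gcongr; linarith
        _ = ε / 2 * Real.exp (γ * |(k : ℝ)|) := by
          rw [hγ, add_mul, Real.exp_add, one_mul]; ring
        _ ≤ ε / 2 * (2 * Real.cosh (γ * (k : ℝ))) := by gcongr
        _ = ε * (1 * Real.cosh (γ * (k : ℝ))) := by ring
        _ ≤ ε * ψ k s := by
          simp only [hψ]
          gcongr
    have hsub : Icc T₀ T₁ ⊆ {s | ∀ k, z k s ≤ ε * ψ k s} := by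
      apply IsClosed.Icc_subset_of_forall_exists_gt
      · have : {s | ∀ k, z k s ≤ ε * ψ k s} ∩ Icc T₀ T₁ =
            ⋂ k, {s ∈ Icc T₀ T₁ | z k s ≤ ε * ψ k s} := by
          ext s
          simp only [mem_inter_iff, mem_ofPred_eq, mem_iInter]
          exact ⟨fun h k => ⟨h.2, h.1 k⟩, fun h => ⟨fun k => (h k).2, (h 0).1⟩⟩
        rw [this]
        refine isClosed_iInter fun k => isClosed_Icc.isClosed_le (hcont k) ?_
        exact fun s _ => ((hψd k s).continuousAt.const_mul ε).continuousWithinAt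
      · intro k
        exact (h0 k).trans (mul_pos hε (hψpos k T₀)).le
      · rintro x ⟨hx, hxI⟩ y hy
        have hnear : ∀ᶠ s in 𝓝[>] x, ∀ k ∈ Finset.Icc (-(N : ℤ)) N, z k s ≤ ε * ψ k s := by
          rw [Filter.eventually_all_finset]
          intro k _
          rcases (hx k).lt_or_eq with hlt | heq
          · have hc : Tendsto (z k) (𝓝[>] x) (𝓝 (z k x)) :=
              (hcont k x (Ico_subset_Icc_self hxI)).mono_left
                (nhdsWithin_le_of_mem (Icc_mem_nhdsGT_of_mem hxI))
            have hc' : Tendsto (fun s => ε * ψ k s) (𝓝[>] x) (𝓝 (ε * ψ k x)) :=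
              ((hψd k x).continuousAt.const_mul ε).tendsto.mono_left nhdsWithin_le_nhds
            exact (hc.eventually_lt hc' hlt).mono fun s hs => hs.le
          · -- At a node where the barrier is touched, `z` grows more slowly than the barrier.
            obtain ⟨d, hd1, hd2⟩ := hd k x hxI (heq ▸ mul_pos hε (hψpos k x))
            have hlap : lap z k x ≤ ε * ((2 * Real.cosh γ - 2) * ψ k x) := by
              have e : lap ψ k x = (2 * Real.cosh γ - 2) * ψ k x := lap_cosh γ g k x
              rw [← e]
              simp only [lap]
              have a1 := hx (k + 1)
              have a2 := hx (k - 1)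
              linarith
            have hF := eventually_neg_of_hasDerivWithinAt
              (hd1.sub ((hψd k x).const_mul ε).hasDerivWithinAt) (by
                have := mul_pos hε (hψpos k x)
                have e : ε * (β * ψ k x) = ε * ((2 * Real.cosh γ - 2) * ψ k x) + ε * ψ k x := by
                  rw [hβ]; ring
                linarith) (by simp [heq])
            exact hF.mono fun s hs => by
              have hs' : z k s - ε * ψ k s < 0 := hs
              linarith
        have hmem : Ioc x (min y T₁) ∈ 𝓝[>] x := Ioc_mem_nhdsGT (lt_min hy hxI.2)
        obtain ⟨s, hs1, hs2⟩ := (hnear.and hmem).exists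
        refine ⟨s, fun k => ?_, hs2.1, hs2.2.trans (min_le_left _ _)⟩
        by_cases hk : k ∈ Finset.Icc (-(N : ℤ)) N
        · exact hs1 k hk
        · exact hfar k hk s ⟨hxI.1.trans hs2.1.le, hs2.2.trans (min_le_right _ _)⟩
    exact fun s hs k => hsub hs k
  intro k s hs
  by_contra! hpos
  have h1 := key (z k s / (2 * ψ k s)) (by have := hψpos k s; positivity) s hs k
  have h2 : z k s / (2 * ψ k s) * ψ k s = z k s / 2 := by
    have := (hψpos k s).ne'
    field_simp
  linarith

/-- Comparison principle: a solution is monotone in the initial values and in the right-hand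
side. -/
theorem IsLatticeSolution.le_of_le {f g u v : ℤ → ℝ → ℝ} {α β T₀ T₁ : ℝ}
    (hu : IsLatticeSolution f α u) (hv : IsLatticeSolution g β v) (hα : α ≤ T₀) (hβ : β ≤ T₀)
    (h0 : ∀ k, u k T₀ ≤ v k T₀) (hfg : ∀ k, ∀ s ∈ Ico T₀ T₁, f k s ≤ g k s) :
    ∀ k, ∀ s ∈ Icc T₀ T₁, u k s ≤ v k s := by
  have hmp := lattice_max_principle (T₀ := T₀) (T₁ := T₁) (z := fun k s => u k s - v k s)
    (fun k => ((hu.continuousOn k).mono fun s hs => hα.trans hs.1).sub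
      ((hv.continuousOn k).mono fun s hs => hβ.trans hs.1)) ?_
    (fun k => sub_nonpos.2 (h0 k)) ?_
  · exact fun k s hs => sub_nonpos.1 (hmp k s hs)
  · obtain ⟨A, a, hA⟩ := hu.growth T₁
    obtain ⟨B, b, hB⟩ := hv.growth T₁
    refine ⟨|A| + |B|, max a b, fun k s hs => ?_⟩
    have h1 := hA k s ⟨hα.trans hs.1, hs.2⟩
    have h2 := hB k s ⟨hβ.trans hs.1, hs.2⟩
    have h3 : A * Real.exp (a * |(k : ℝ)|) ≤ |A| * Real.exp (max a b * |(k : ℝ)|) := by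
      gcongr
      · exact le_abs_self A
      · exact le_max_left a b
    have h4 : B * Real.exp (b * |(k : ℝ)|) ≤ |B| * Real.exp (max a b * |(k : ℝ)|) := by
      gcongr
      · exact le_abs_self B
      · exact le_max_right a b
    have h5 := (abs_le.1 h1).2
    have h6 := (abs_le.1 h2).1
    rw [add_mul]
    linarith
  · intro k s hs _
    refine ⟨_, (hu.deriv k s (hα.trans hs.1)).sub (hv.deriv k s (hβ.trans hs.1)), ?_⟩
    have := hfg k s hs
    simp only [lap]
    linarith

theorem IsLatticeSolution.eq_of_eq {f g u v : ℤ → ℝ → ℝ} {α β T₀ T₁ : ℝ}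
    (hu : IsLatticeSolution f α u) (hv : IsLatticeSolution g β v) (hα : α ≤ T₀) (hβ : β ≤ T₀)
    (h0 : ∀ k, u k T₀ = v k T₀) (hfg : ∀ k, ∀ s ∈ Ico T₀ T₁, f k s = g k s) :
    ∀ k, ∀ s ∈ Icc T₀ T₁, u k s = v k s := fun k s hs =>
  le_antisymm (hu.le_of_le hv hα hβ (fun k => (h0 k).le) (fun k s hs => (hfg k s hs).le) k s hs)
    (hv.le_of_le hu hβ hα (fun k => (h0 k).ge) (fun k s hs => (hfg k s hs).ge) k s hs)

theorem exists_exp_bound_sq (B C : ℝ) : ∃ A α : ℝ, ∀ k : ℤ, ∀ x : ℝ,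
    |x| ≤ B * (k : ℝ) ^ 2 + C → |x| ≤ A * Real.exp (α * |(k : ℝ)|) := by
  refine ⟨2 * |B| + |C|, 1, fun k x hx => hx.trans ?_⟩
  have h1 : (k : ℝ) ^ 2 ≤ 2 * Real.exp (1 * |(k : ℝ)|) := by
    have := Real.quadratic_le_exp_of_nonneg (abs_nonneg (k : ℝ))
    rw [sq_abs] at this
    rw [one_mul]
    linarith [abs_nonneg (k : ℝ)]
  have h2 : 1 ≤ Real.exp (1 * |(k : ℝ)|) := Real.one_le_exp (by positivity)
  calc B * (k : ℝ) ^ 2 + C ≤ |B| * (k : ℝ) ^ 2 + |C| * 1 := by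
        rw [mul_one]
        gcongr
        · exact le_abs_self B
        · exact le_abs_self C
    _ ≤ |B| * (2 * Real.exp (1 * |(k : ℝ)|)) + |C| * Real.exp (1 * |(k : ℝ)|) := by gcongr
    _ = _ := by ring

/-- The solution in which no node ever switches. -/
theorem isLatticeSolution_quadratic (b c : ℝ) :
    IsLatticeSolution (fun _ _ => b) 0 (fun k s => -c * (k : ℝ) ^ 2 + (b - 2 * c) * s) where
  continuousOn k := by fun_prop
  growth T := by
    obtain ⟨A, α, h⟩ := exists_exp_bound_sq |c| (|b - 2 * c| * |T|)
    refine ⟨A, α, fun k s hs => h k _ ((abs_add_le _ _).trans ?_)⟩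
    rw [abs_mul, abs_mul, abs_neg, abs_sq]
    have : |s| ≤ |T| := by
      rw [abs_of_nonneg hs.1]; exact hs.2.trans (le_abs_self T)
    gcongr
  deriv k s _ := by
    have h : HasDerivAt (fun s : ℝ => -c * (k : ℝ) ^ 2 + (b - 2 * c) * s) ((b - 2 * c) * 1) s :=
      ((hasDerivAt_id s).const_mul _).const_add _
    refine h.hasDerivWithinAt.congr_deriv ?_
    simp only [lap]; push_cast; ring

/-! ### Solutions of the hysteresis problem -/

theorem hysteresis_congr {h₁ : ℝ} {v w : ℝ → ℝ} {s : ℝ} (h : ∀ r ∈ Icc 0 s, v r = w r) :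
    hysteresis h₁ v s = hysteresis h₁ w s := by
  have e : (∀ r ∈ Icc 0 s, v r < 0) = ∀ r ∈ Icc 0 s, w r < 0 :=
    propext (forall₂_congr fun r hr => by rw [h r hr])
  unfold hysteresis
  congr 1

theorem hysteresis_le {h₁ : ℝ} (hh : 0 ≤ h₁) (w : ℝ → ℝ) (s : ℝ) : hysteresis h₁ w s ≤ h₁ := by
  unfold hysteresis; split_ifs <;> simp [hh]

theorem hysteresis_of_neg {h₁ : ℝ} {w : ℝ → ℝ} {s : ℝ} (h : ∀ r ∈ Icc 0 s, w r < 0) :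
    hysteresis h₁ w s = h₁ := if_pos h

theorem hysteresis_of_nonneg {h₁ : ℝ} {w : ℝ → ℝ} {r s : ℝ} (hr : 0 ≤ r) (hrs : r ≤ s)
    (h : 0 ≤ w r) : hysteresis h₁ w s = 0 :=
  if_neg fun hn => absurd (hn r ⟨hr, hrs⟩) (not_lt.2 h)

theorem hysteresis_anti {h₁ : ℝ} (hh : 0 ≤ h₁) (w : ℝ → ℝ) {r s : ℝ} (hrs : r ≤ s) :
    hysteresis h₁ w s ≤ hysteresis h₁ w r := by
  by_cases h : ∀ q ∈ Icc 0 r, w q < 0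
  · rw [hysteresis_of_neg h]; exact hysteresis_le hh w s
  · push Not at h
    obtain ⟨q, hq, hq'⟩ := h
    rw [hysteresis_of_nonneg hq.1 hq.2 hq', hysteresis_of_nonneg hq.1 (hq.2.trans hrs) hq']

theorem IsSwitchingMoment.hysteresis_eq {h₁ : ℝ} {w : ℝ → ℝ} {t : ℝ} (h : IsSwitchingMoment w t)
    (s : ℝ) : hysteresis h₁ w s = if t ≤ s then 0 else h₁ := by
  split_ifs with hts
  · exact hysteresis_of_nonneg h.1 hts h.2.1.ge
  · exact hysteresis_of_neg fun r hr => h.2.2 r ⟨hr.1, hr.2.trans_lt (not_le.1 hts)⟩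

/-- Far nodes stay negative on bounded time intervals, by comparison with the solution in which no
node switches. -/
theorem IsHysteresisSolution.le_quadratic {h₁ c : ℝ} (hh : 0 ≤ h₁) {u : ℤ → ℝ → ℝ}
    (hu : IsHysteresisSolution h₁ c u) (k : ℤ) {s : ℝ} (hs : 0 ≤ s) :
    u k s ≤ -c * (k : ℝ) ^ 2 + (h₁ - 2 * c) * s :=
  hu.1.le_of_le (isLatticeSolution_quadratic h₁ c) le_rfl le_rfl
    (fun k => by rw [hu.2 k]; simp) (T₁ := s) (fun k s _ => hysteresis_le hh _ _) k s ⟨hs, le_rfl⟩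

theorem IsHysteresisSolution.reflect {h₁ c : ℝ} {u : ℤ → ℝ → ℝ}
    (hu : IsHysteresisSolution h₁ c u) : IsHysteresisSolution h₁ c (fun k => u (-k)) := by
  refine ⟨⟨fun k => hu.1.continuousOn (-k), fun T => ?_, fun k s hs => ?_⟩, fun k => ?_⟩
  · obtain ⟨A, α, h⟩ := hu.1.growth T
    exact ⟨A, α, fun k s hs => by simpa using h (-k) s hs⟩
  · convert hu.1.deriv (-k) s hs using 1
    simp only [lap]
    rw [show -(k + 1) = -k - 1 by ring, show -(k - 1) = -k + 1 by ring]
    ring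
  · simp only [hu.2 (-k)]; push_cast; ring

/-- The discontinuous hysteresis problem has at most one solution: on a bounded time interval only
finitely many nodes can switch, so two solutions that agree up to some time have equal outputs
slightly beyond it. -/
theorem IsHysteresisSolution.unique {h₁ c : ℝ} (hc : 0 < c) (hh : 0 ≤ h₁) {u v : ℤ → ℝ → ℝ}
    (hu : IsHysteresisSolution h₁ c u) (hv : IsHysteresisSolution h₁ c v) (k : ℤ) {T : ℝ}
    (hT : 0 ≤ T) : u k T = v k T := by
  -- Nodes beyond `N` do not switch on `[0, T]`.
  obtain ⟨N, hN⟩ := exists_nat_gt (|h₁ - 2 * c| * T / c)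
  have hfar : ∀ w : ℤ → ℝ → ℝ, IsHysteresisSolution h₁ c w → ∀ k : ℤ,
      k ∉ Finset.Icc (-(N : ℤ)) N → ∀ s ∈ Icc 0 T, w k s < 0 := by
    intro w hw k hk s hs
    have hk' : (N : ℝ) + 1 ≤ |(k : ℝ)| := by
      have : (N : ℤ) + 1 ≤ |k| := by
        by_contra! hlt
        exact hk (Finset.mem_Icc.2 (abs_le.1 (by omega)))
      exact_mod_cast this
    have h1 : |h₁ - 2 * c| * T < N * c := (div_lt_iff₀ hc).1 hN
    have h2 : (N : ℝ) ≤ (k : ℝ) ^ 2 := by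
      rw [← sq_abs]
      nlinarith [Nat.cast_nonneg (α := ℝ) N]
    have h3 : (h₁ - 2 * c) * s ≤ |h₁ - 2 * c| * T :=
      mul_le_mul (le_abs_self _) hs.2 hs.1 (abs_nonneg _)
    have h4 := hw.le_quadratic hh k hs.1
    nlinarith
  have hsub : Icc 0 T ⊆ {s | ∀ r ∈ Icc 0 s, ∀ k, u k r = v k r} := by
    apply IsClosed.Icc_subset_of_forall_exists_gt
    · have hcl : ∀ k, IsClosed {s ∈ Icc 0 T | u k s = v k s} := fun k =>
        isClosed_Icc.isClosed_eq ((hu.1.continuousOn k).mono fun s hs => hs.1)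
          ((hv.1.continuousOn k).mono fun s hs => hs.1)
      refine isClosed_of_closure_subset fun x hx => ?_
      have hxT : x ∈ Icc 0 T := closure_minimal inter_subset_right isClosed_Icc hx
      refine ⟨fun r hr k => ?_, hxT⟩
      rcases hr.2.lt_or_eq with hlt | rfl
      · obtain ⟨y, hy1, hy2⟩ := mem_closure_iff_nhds.1 hx (Ioi r) (Ioi_mem_nhds hlt)
        exact hy2.1 r ⟨hr.1, le_of_lt hy1⟩ k
      · have : closure ({s | ∀ r ∈ Icc 0 s, ∀ k, u k r = v k r} ∩ Icc 0 T) ⊆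
            {s ∈ Icc 0 T | u k s = v k s} :=
          closure_minimal (fun s hs => ⟨hs.2, hs.1 s ⟨hs.2.1, le_rfl⟩ k⟩) (hcl k)
        exact (this hx).2
    · intro r hr k
      have hr0 : r = 0 := le_antisymm hr.2 hr.1
      rw [hr0, hu.2, hv.2]
    · rintro x ⟨hx, hxI⟩ y hy
      -- A node that has not switched by the time `x` keeps its output slightly beyond `x`.
      have ev : ∀ w : ℤ → ℝ → ℝ, IsHysteresisSolution h₁ c w → ∀ k, (∀ r ∈ Icc 0 x, w k r < 0) →
          ∀ᶠ s in 𝓝[>] x, hysteresis h₁ (w k) s = h₁ := by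
        intro w hw k hwx
        have h1 : ∀ᶠ s in 𝓝[>] x, w k s < 0 :=
          ((hw.1.continuousOn k x hxI.1).mono_left (nhdsWithin_mono x
            (fun s (hs : x < s) => hxI.1.trans hs.le))).eventually_lt_const (hwx x ⟨hxI.1, le_rfl⟩)
        obtain ⟨z, hz, hzs⟩ := mem_nhdsGT_iff_exists_Ioc_subset.1 h1
        filter_upwards [Ioc_mem_nhdsGT hz] with s hs
        refine hysteresis_of_neg fun r hr => ?_
        rcases le_or_gt r x with hrx | hrx
        · exact hwx r ⟨hr.1, hrx⟩
        · exact hzs ⟨hrx, hr.2.trans hs.2⟩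
      have hnear : ∀ᶠ s in 𝓝[>] x, ∀ k ∈ Finset.Icc (-(N : ℤ)) N,
          hysteresis h₁ (u k) s = hysteresis h₁ (v k) s := by
        rw [Filter.eventually_all_finset]
        intro k _
        by_cases hneg : ∀ r ∈ Icc 0 x, u k r < 0
        · filter_upwards [ev u hu k hneg, ev v hv k fun r hr => hx r hr k ▸ hneg r hr] with s h1 h2
          rw [h1, h2]
        · push Not at hneg
          obtain ⟨r, hr, hr'⟩ := hneg
          filter_upwards [self_mem_nhdsWithin] with s (hs : x < s)
          rw [hysteresis_of_nonneg hr.1 (hr.2.trans hs.le) hr',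
            hysteresis_of_nonneg hr.1 (hr.2.trans hs.le) (hx r hr k ▸ hr')]
      obtain ⟨z, hz, hzs⟩ := mem_nhdsGT_iff_exists_Ioc_subset.1 hnear
      have hout : ∀ k, ∀ s ∈ Ico x (min z (min y T)),
          hysteresis h₁ (u k) s = hysteresis h₁ (v k) s := by
        intro k s hs
        have hsz : s ≤ z := hs.2.le.trans (min_le_left _ _)
        have hsT : s ≤ T := hs.2.le.trans ((min_le_right _ _).trans (min_le_right _ _))
        by_cases hk : k ∈ Finset.Icc (-(N : ℤ)) N
        · rcases hs.1.eq_or_lt with rfl | hxs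
          · exact hysteresis_congr fun r hr => hx r hr k
          · exact hzs ⟨hxs, hsz⟩ k hk
        · rw [hysteresis_of_neg fun r hr => hfar u hu k hk r ⟨hr.1, hr.2.trans hsT⟩,
            hysteresis_of_neg fun r hr => hfar v hv k hk r ⟨hr.1, hr.2.trans hsT⟩]
      have hlt : x < min z (min y T) := lt_min hz (lt_min hy hxI.2)
      refine ⟨min z (min y T), fun r hr k => ?_, hlt, (min_le_right _ _).trans (min_le_left _ _)⟩
      rcases le_or_gt r x with hrx | hrx
      · exact hx r ⟨hr.1, hrx⟩ k
      · exact hu.1.eq_of_eq hv.1 hxI.1 hxI.1 (hx x ⟨hxI.1, le_rfl⟩) hout k r ⟨hrx.le, hr.2⟩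
  exact hsub ⟨hT, le_rfl⟩ T ⟨hT, le_rfl⟩ k

/-! ### The heat kernel of the lattice -/

/-- The symbol `2 - 2 cos θ` of the negative lattice Laplacian. -/
noncomputable def symbol (θ : ℝ) : ℝ := 2 - 2 * Real.cos θ

theorem continuous_symbol : Continuous symbol := by unfold symbol; fun_prop

theorem symbol_nonneg (θ : ℝ) : 0 ≤ symbol θ := by
  unfold symbol; linarith [Real.cos_le_one θ]

theorem symbol_le_four (θ : ℝ) : symbol θ ≤ 4 := by
  unfold symbol; linarith [Real.neg_one_le_cos θ]

/-- The heat kernel of `ℤ`, i.e. the solution of `dp/ds = Δ p` that starts from the unit mass at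
the origin, as a Fourier integral. -/
noncomputable def heatKer (m : ℤ) (s : ℝ) : ℝ :=
  (1 / Real.pi) * ∫ θ in (0 : ℝ)..Real.pi, Real.exp (-s * symbol θ) * Real.cos ((m : ℝ) * θ)

theorem hasDerivAt_integral_exp_symbol {g : ℝ → ℝ} (hg : Continuous g) (s : ℝ) :
    HasDerivAt (fun s => ∫ θ in (0 : ℝ)..Real.pi, Real.exp (-s * symbol θ) * g θ)
      (∫ θ in (0 : ℝ)..Real.pi, Real.exp (-s * symbol θ) * (-symbol θ * g θ)) s := by
  have hsym := continuous_symbol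
  refine (intervalIntegral.hasDerivAt_integral_of_dominated_loc_of_deriv_le
    (F' := fun s θ => Real.exp (-s * symbol θ) * (-symbol θ * g θ))
    (bound := fun θ => Real.exp ((|s| + 1) * 4) * (4 * |g θ|))
    (Metric.ball_mem_nhds s one_pos) ?_ ?_ ?_ ?_ ?_ ?_).2
  · exact Eventually.of_forall fun x => by
      have : Continuous fun θ => Real.exp (-x * symbol θ) * g θ := by fun_prop
      exact this.aestronglyMeasurable
  · apply Continuous.intervalIntegrable; fun_prop
  · have : Continuous fun θ => Real.exp (-s * symbol θ) * (-symbol θ * g θ) := by fun_prop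
    exact this.aestronglyMeasurable
  · refine Eventually.of_forall fun θ _ x hx => ?_
    rw [Metric.mem_ball, Real.dist_eq] at hx
    have hx' : -x ≤ |s| + 1 := by
      have h1 := (abs_lt.1 hx).1
      have h2 := neg_abs_le s
      linarith
    rw [Real.norm_eq_abs, abs_mul, abs_mul, abs_neg, abs_of_nonneg (symbol_nonneg θ),
      abs_of_pos (Real.exp_pos _)]
    have h4 := symbol_le_four θ
    have h0 := symbol_nonneg θ
    have hexp : -x * symbol θ ≤ (|s| + 1) * 4 :=
      (mul_le_mul_of_nonneg_right hx' h0).trans (mul_le_mul_of_nonneg_left h4 (by positivity))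
    gcongr
  · apply Continuous.intervalIntegrable; fun_prop
  · refine Eventually.of_forall fun θ _ x _ => ?_
    have h1 : HasDerivAt (fun x : ℝ => Real.exp (-x * symbol θ))
        (Real.exp (-x * symbol θ) * (-1 * symbol θ)) x :=
      (((hasDerivAt_id x).neg).mul_const (symbol θ)).exp
    refine (h1.mul_const (g θ)).congr_deriv ?_
    ring

theorem lap_heatKer (m : ℤ) (s : ℝ) : lap heatKer m s =
    (1 / Real.pi) * ∫ θ in (0 : ℝ)..Real.pi,
      Real.exp (-s * symbol θ) * (-symbol θ * Real.cos ((m : ℝ) * θ)) := by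
  have hsym := continuous_symbol
  have hi : ∀ k : ℤ, IntervalIntegrable
      (fun θ => Real.exp (-s * symbol θ) * Real.cos ((k : ℝ) * θ)) MeasureTheory.volume 0 Real.pi :=
    fun k => by apply Continuous.intervalIntegrable; fun_prop
  simp only [lap, heatKer]
  rw [← mul_assoc, mul_comm 2 (1 / Real.pi), mul_assoc, ← mul_sub, ← mul_add,
    ← intervalIntegral.integral_const_mul,
    ← intervalIntegral.integral_sub (hi _) ((hi _).const_mul 2),
    ← intervalIntegral.integral_add ((hi _).sub ((hi _).const_mul 2)) (hi _)]
  congr 1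
  refine intervalIntegral.integral_congr fun θ _ => ?_
  simp only [symbol, Int.cast_add, Int.cast_sub, Int.cast_one, add_mul, sub_mul, one_mul,
    Real.cos_add, Real.cos_sub]
  ring

theorem hasDerivAt_heatKer (m : ℤ) (s : ℝ) : HasDerivAt (heatKer m) (lap heatKer m s) s := by
  rw [lap_heatKer]
  exact (hasDerivAt_integral_exp_symbol (by fun_prop) s).const_mul _

theorem continuous_heatKer (m : ℤ) : Continuous (heatKer m) :=
  continuous_iff_continuousAt.2 fun s => (hasDerivAt_heatKer m s).continuousAt

theorem heatKer_zero (m : ℤ) : heatKer m 0 = if m = 0 then 1 else 0 := by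
  have hpi := Real.pi_pos.ne'
  simp only [heatKer, neg_zero, zero_mul, Real.exp_zero, one_mul]
  split_ifs with h
  · subst h; simp
  · have hm : (m : ℝ) ≠ 0 := Int.cast_ne_zero.2 h
    rw [intervalIntegral.integral_comp_mul_left (fun x => Real.cos x) hm, integral_cos]
    simp [Real.sin_int_mul_pi]

theorem heatKer_neg (m : ℤ) (s : ℝ) : heatKer (-m) s = heatKer m s := by
  simp only [heatKer, Int.cast_neg, neg_mul, Real.cos_neg]

theorem abs_heatKer_le_one (m : ℤ) {s : ℝ} (hs : 0 ≤ s) : |heatKer m s| ≤ 1 := by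
  have h : ‖∫ θ in (0 : ℝ)..Real.pi, Real.exp (-s * symbol θ) * Real.cos ((m : ℝ) * θ)‖ ≤
      1 * |Real.pi - 0| := by
    refine intervalIntegral.norm_integral_le_of_norm_le_const fun θ _ => ?_
    rw [Real.norm_eq_abs, abs_mul, abs_of_pos (Real.exp_pos _)]
    refine mul_le_one₀ (Real.exp_le_one_iff.2 ?_) (abs_nonneg _) (Real.abs_cos_le_one _)
    have := mul_nonneg hs (symbol_nonneg θ)
    linarith
  rw [sub_zero, one_mul, abs_of_pos Real.pi_pos, Real.norm_eq_abs] at h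
  rw [heatKer, abs_mul, abs_of_pos (by positivity), one_div, inv_mul_le_iff₀ Real.pi_pos, mul_one]
  exact h

theorem heatKer_nonneg (m : ℤ) {s : ℝ} (hs : 0 ≤ s) : 0 ≤ heatKer m s := by
  have h := lattice_max_principle (T₀ := 0) (T₁ := s) (z := fun k s => -heatKer k s)
    (fun k => (continuous_heatKer k).neg.continuousOn)
    ⟨1, 0, fun k r hr => by
      simpa using (neg_le_abs _).trans (abs_heatKer_le_one k hr.1)⟩
    (fun k => by rw [heatKer_zero]; split_ifs <;> simp)
    (fun k r _ _ => ⟨_, (hasDerivAt_heatKer k r).neg.hasDerivWithinAt, by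
      simp only [lap]; linarith⟩) m s ⟨hs, le_rfl⟩
  exact neg_nonpos.1 h

/-- The lattice heat kernel is decreasing in the distance from the origin: the differences satisfy
the heat equation on the half-line, and the maximum principle applies to their extension by
zero. -/
theorem heatKer_succ_le {m : ℤ} (hm : 0 ≤ m) {s : ℝ} (hs : 0 ≤ s) :
    heatKer (m + 1) s ≤ heatKer m s := by
  set z : ℤ → ℝ → ℝ := fun k s => if 0 ≤ k then heatKer (k + 1) s - heatKer k s else 0 with hz
  have hpos : ∀ k, 0 ≤ k → z k = fun s => heatKer (k + 1) s - heatKer k s := fun k hk => by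
    simp [hz, hk]
  have hneg : ∀ k, ¬ 0 ≤ k → z k = fun _ => 0 := fun k hk => by simp [hz, hk]
  have h := lattice_max_principle (T₀ := 0) (T₁ := s) (z := z) ?_ ?_ ?_ ?_ m s ⟨hs, le_rfl⟩
  · rw [hpos m hm] at h
    exact sub_nonpos.1 h
  · intro k
    by_cases hk : 0 ≤ k
    · rw [hpos k hk]
      exact ((continuous_heatKer _).sub (continuous_heatKer _)).continuousOn
    · rw [hneg k hk]; exact continuousOn_const
  · refine ⟨2, 0, fun k r hr => ?_⟩
    by_cases hk : 0 ≤ k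
    · rw [hpos k hk]
      have h1 := (abs_le.1 (abs_heatKer_le_one (k + 1) hr.1)).2
      have h2 := (abs_le.1 (abs_heatKer_le_one k hr.1)).1
      simp only [zero_mul, Real.exp_zero]; linarith
    · rw [hneg k hk]; simp
  · intro k
    by_cases hk : 0 ≤ k
    · rw [hpos k hk]
      simp only [heatKer_zero]
      rw [if_neg (by omega)]; split_ifs <;> simp
    · rw [hneg k hk]
  · intro k r hr hzk
    by_cases hk : 0 ≤ k
    · refine ⟨_, by
        rw [hpos k hk]
        exact ((hasDerivAt_heatKer (k + 1) r).sub (hasDerivAt_heatKer k r)).hasDerivWithinAt, ?_⟩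
      rcases hk.eq_or_lt with rfl | hk'
      · -- At the edge of the half-line, evenness of the kernel replaces the missing neighbour.
        have e := heatKer_neg 1 r
        rw [hpos 0 le_rfl] at hzk
        rw [lap, lap, lap, hpos (0 + 1) (by norm_num), hpos 0 le_rfl, hneg (0 - 1) (by norm_num)]
        norm_num at e hzk ⊢
        rw [e]
        linarith
      · rw [lap, lap, lap, hpos (k + 1) (by omega), hpos k hk, hpos (k - 1) (by omega)]
        simp only [add_sub_cancel_right, sub_add_cancel]
        linarith
    · rw [hneg k hk] at hzk
      exact absurd hzk (lt_irrefl _)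

/-- Exponential (Chernoff) bound for the lattice heat kernel. -/
theorem heatKer_le_exp (γ : ℝ) (m : ℤ) {s : ℝ} (hs : 0 ≤ s) :
    heatKer m s ≤ Real.exp (-γ * m + s * (2 * Real.cosh γ - 2)) := by
  have hE : ∀ (k : ℤ) (r : ℝ), HasDerivAt
      (fun r => Real.exp (-γ * k + r * (2 * Real.cosh γ - 2)))
      (Real.exp (-γ * k + r * (2 * Real.cosh γ - 2)) * (1 * (2 * Real.cosh γ - 2))) r := fun k r =>
    (((hasDerivAt_id r).mul_const _).const_add _).exp
  have h := lattice_max_principle (T₀ := 0) (T₁ := s)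
    (z := fun k r => heatKer k r - Real.exp (-γ * k + r * (2 * Real.cosh γ - 2)))
    (fun k => by
      have := continuous_heatKer k
      apply Continuous.continuousOn; fun_prop)
    ⟨1, 0, fun k r hr => by
      have h1 := (abs_le.1 (abs_heatKer_le_one k hr.1)).2
      have h2 := Real.exp_pos (-γ * k + r * (2 * Real.cosh γ - 2))
      simp only [zero_mul, Real.exp_zero]; linarith⟩
    (fun k => by
      rw [heatKer_zero]
      split_ifs with hk
      · simp [hk]
      · have h2 := Real.exp_pos (-γ * k + 0 * (2 * Real.cosh γ - 2))
        linarith)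
    (fun k r _ _ => ⟨_, ((hasDerivAt_heatKer k r).sub (hE k r)).hasDerivWithinAt, by
      have e1 : Real.exp (-γ * ((k + 1 : ℤ) : ℝ) + r * (2 * Real.cosh γ - 2)) =
          Real.exp (-γ * k + r * (2 * Real.cosh γ - 2)) * Real.exp (-γ) := by
        rw [← Real.exp_add]; congr 1; push_cast; ring
      have e2 : Real.exp (-γ * ((k - 1 : ℤ) : ℝ) + r * (2 * Real.cosh γ - 2)) =
          Real.exp (-γ * k + r * (2 * Real.cosh γ - 2)) * Real.exp γ := by
        rw [← Real.exp_add]; congr 1; push_cast; ring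
      simp only [lap, e1, e2]
      set X := Real.exp (-γ * k + r * (2 * Real.cosh γ - 2))
      rw [Real.cosh_eq]
      apply le_of_eq; ring⟩) m s ⟨hs, le_rfl⟩
  exact sub_nonpos.1 h

/-! ### The Green function of the lattice and its tails -/

/-- The response of the lattice to a unit source at the origin that is switched on at time `0`:
the solution of `dy/ds = Δ y + δ₀`, `y(0) = 0`, extended by zero to negative times. -/
noncomputable def latticeGreen (m : ℤ) (s : ℝ) : ℝ := ∫ r in (0 : ℝ)..max s 0, heatKer m r

theorem latticeGreen_of_nonpos (m : ℤ) {s : ℝ} (hs : s ≤ 0) : latticeGreen m s = 0 := by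
  simp [latticeGreen, max_eq_right hs]

theorem latticeGreen_neg (m : ℤ) (s : ℝ) : latticeGreen (-m) s = latticeGreen m s := by
  simp only [latticeGreen, heatKer_neg]

theorem intervalIntegrable_heatKer (m : ℤ) (a b : ℝ) :
    IntervalIntegrable (heatKer m) MeasureTheory.volume a b :=
  (continuous_heatKer m).intervalIntegrable a b

theorem hasDerivAt_integral_heatKer (m : ℤ) (s : ℝ) :
    HasDerivAt (fun s => ∫ r in (0 : ℝ)..s, heatKer m r) (heatKer m s) s :=
  ((continuous_heatKer m).integral_hasStrictDerivAt 0 s).hasDerivAt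

theorem continuous_latticeGreen (m : ℤ) : Continuous (latticeGreen m) := by
  have h : Continuous fun s => ∫ r in (0 : ℝ)..s, heatKer m r :=
    continuous_iff_continuousAt.2 fun s => (hasDerivAt_integral_heatKer m s).continuousAt
  exact h.comp (continuous_id.max continuous_const)

theorem hasDerivAt_latticeGreen (m : ℤ) {s : ℝ} (hs : 0 < s) :
    HasDerivAt (latticeGreen m) (heatKer m s) s := by
  refine (hasDerivAt_integral_heatKer m s).congr_of_eventuallyEq ?_
  filter_upwards [lt_mem_nhds hs] with r hr
  simp [latticeGreen, max_eq_left hr.le]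

theorem lap_latticeGreen (m : ℤ) {s : ℝ} (hs : 0 ≤ s) :
    lap latticeGreen m s = heatKer m s - if m = 0 then 1 else 0 := by
  have h := intervalIntegral.integral_eq_sub_of_hasDerivAt (a := 0) (b := s)
    (fun r _ => hasDerivAt_heatKer m r) (by
      exact ((intervalIntegrable_heatKer _ _ _).sub
        ((intervalIntegrable_heatKer _ _ _).const_mul 2)).add (intervalIntegrable_heatKer _ _ _))
  rw [heatKer_zero] at h
  rw [← h]
  simp only [lap, latticeGreen, max_eq_left hs]
  rw [intervalIntegral.integral_add ((intervalIntegrable_heatKer _ _ _).sub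
        ((intervalIntegrable_heatKer _ _ _).const_mul 2)) (intervalIntegrable_heatKer _ _ _),
    intervalIntegral.integral_sub (intervalIntegrable_heatKer _ _ _)
        ((intervalIntegrable_heatKer _ _ _).const_mul 2), intervalIntegral.integral_const_mul]

theorem hasDerivWithinAt_latticeGreen (m : ℤ) (s : ℝ) :
    HasDerivWithinAt (latticeGreen m)
      (lap latticeGreen m s + if m = 0 ∧ 0 ≤ s then 1 else 0) (Ici s) s := by
  rcases le_or_gt 0 s with hs | hs
  · simp only [lap_latticeGreen m hs, hs, and_true, sub_add_cancel]
    refine (hasDerivAt_integral_heatKer m s).hasDerivWithinAt.congr (fun r hr => ?_) ?_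
    · simp [latticeGreen, max_eq_left (hs.trans hr)]
    · simp [latticeGreen, max_eq_left hs]
  · have e : lap latticeGreen m s = 0 := by simp [lap, latticeGreen_of_nonpos _ hs.le]
    rw [e, if_neg (fun h => absurd h.2 (not_le.2 hs)), add_zero]
    refine ((hasDerivAt_const s (0 : ℝ)).congr_of_eventuallyEq ?_).hasDerivWithinAt
    filter_upwards [gt_mem_nhds hs] with r hr
    exact latticeGreen_of_nonpos m (le_of_lt hr)

theorem latticeGreen_nonneg (m : ℤ) (s : ℝ) : 0 ≤ latticeGreen m s :=
  intervalIntegral.integral_nonneg (le_max_right _ _) fun _ hr => heatKer_nonneg m hr.1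

theorem latticeGreen_le (m : ℤ) (s : ℝ) : latticeGreen m s ≤ max s 0 := by
  have h := intervalIntegral.integral_mono_on (le_max_right s 0)
    (intervalIntegrable_heatKer m 0 (max s 0)) intervalIntegrable_const
    fun r hr => (abs_le.1 (abs_heatKer_le_one m hr.1)).2
  rw [intervalIntegral.integral_const, sub_zero, smul_eq_mul, mul_one] at h
  exact h

/-- The downward step `y_m - y_{m+1}` of the lattice Green function. For `m ≥ 0` it is the
probability that a continuous-time simple random walk has passed `m` at time `s`. -/
noncomputable def latticeTail (m : ℤ) (s : ℝ) : ℝ := latticeGreen m s - latticeGreen (m + 1) s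

theorem latticeTail_eq_integral (m : ℤ) (s : ℝ) :
    latticeTail m s = ∫ r in (0 : ℝ)..max s 0, (heatKer m r - heatKer (m + 1) r) := by
  rw [intervalIntegral.integral_sub (intervalIntegrable_heatKer _ _ _)
    (intervalIntegrable_heatKer _ _ _)]
  rfl

theorem latticeTail_of_nonpos (m : ℤ) {s : ℝ} (hs : s ≤ 0) : latticeTail m s = 0 := by
  simp [latticeTail, latticeGreen_of_nonpos _ hs]

theorem latticeTail_mono {m : ℤ} (hm : 0 ≤ m) : Monotone (latticeTail m) := by
  intro r s hrs
  rw [latticeTail_eq_integral, latticeTail_eq_integral]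
  have hi : ∀ a b, IntervalIntegrable (fun r => heatKer m r - heatKer (m + 1) r)
      MeasureTheory.volume a b := fun a b =>
    (intervalIntegrable_heatKer _ _ _).sub (intervalIntegrable_heatKer _ _ _)
  have hle : max r 0 ≤ max s 0 := max_le_max_right 0 hrs
  rw [← intervalIntegral.integral_add_adjacent_intervals (hi 0 (max r 0)) (hi (max r 0) (max s 0))]
  have : 0 ≤ ∫ r in max r 0..max s 0, (heatKer m r - heatKer (m + 1) r) :=
    intervalIntegral.integral_nonneg hle fun x hx =>
      sub_nonneg.2 (heatKer_succ_le hm ((le_max_right _ _).trans hx.1))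
  linarith

theorem latticeTail_nonneg {m : ℤ} (hm : 0 ≤ m) (s : ℝ) : 0 ≤ latticeTail m s := by
  rcases le_or_gt s 0 with hs | hs
  · rw [latticeTail_of_nonpos m hs]
  · exact (latticeTail_of_nonpos m le_rfl).ge.trans (latticeTail_mono hm hs.le)

theorem latticeTail_succ {m : ℤ} (hm : 0 ≤ m) {s : ℝ} (hs : 0 ≤ s) :
    latticeTail (m + 1) s = latticeTail m s - heatKer (m + 1) s := by
  have h := lap_latticeGreen (m + 1) hs
  rw [if_neg (by omega), sub_zero] at h
  simp only [lap, add_sub_cancel_right] at h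
  simp only [latticeTail]
  linarith

theorem latticeTail_zero {s : ℝ} (hs : 0 ≤ s) : latticeTail 0 s = 1 / 2 - heatKer 0 s / 2 := by
  have h := lap_latticeGreen 0 hs
  have e := latticeGreen_neg 1 s
  simp only [lap, if_true, zero_sub, zero_add, e] at h
  simp only [latticeTail, zero_add]
  linarith

theorem latticeTail_anti {m m' : ℤ} (hm : 0 ≤ m) (hmm : m ≤ m') (s : ℝ) :
    latticeTail m' s ≤ latticeTail m s := by
  rcases le_or_gt s 0 with hs | hs
  · rw [latticeTail_of_nonpos _ hs, latticeTail_of_nonpos _ hs]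
  · induction m', hmm using Int.leInduction with
    | base => exact le_rfl
    | succ k hk ih =>
      rw [latticeTail_succ (hm.trans hk) hs.le]
      linarith [heatKer_nonneg (k + 1) hs.le]

open MeasureTheory

/-! ### Rates of decay of the lattice heat kernel -/

theorem symbol_le_sq (θ : ℝ) : symbol θ ≤ θ ^ 2 := by
  unfold symbol; linarith [Real.one_sub_sq_div_two_le_cos (x := θ)]

theorem mul_sq_le_symbol {θ : ℝ} (h : |θ| ≤ Real.pi) : 4 / Real.pi ^ 2 * θ ^ 2 ≤ symbol θ := by
  have := Real.cos_le_one_sub_mul_cos_sq h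
  have e : 4 / Real.pi ^ 2 * θ ^ 2 = 2 * (2 / Real.pi ^ 2 * θ ^ 2) := by ring
  unfold symbol; linarith

/-- The Gaussian moment weight `θ^q exp (-4 s θ² / π²)`, which dominates the Fourier integrands of
the lattice heat kernel on `[0, π]`. -/
noncomputable def momentWeight (q : ℕ) (s θ : ℝ) : ℝ :=
  θ ^ q * Real.exp (-s * (4 / Real.pi ^ 2 * θ ^ 2))

theorem continuous_momentWeight (q : ℕ) (s : ℝ) : Continuous (momentWeight q s) := by
  unfold momentWeight; fun_prop

theorem momentWeight_nonneg (q : ℕ) (s : ℝ) {θ : ℝ} (h : 0 ≤ θ) : 0 ≤ momentWeight q s θ := by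
  unfold momentWeight; positivity

theorem integrableOn_momentWeight (q : ℕ) {s : ℝ} (hs : 0 < s) :
    IntegrableOn (momentWeight q s) (Ioi 0) := by
  have hb : 0 < s * (4 / Real.pi ^ 2) := by have := Real.pi_pos; positivity
  refine (integrableOn_rpow_mul_exp_neg_mul_rpow (p := 2) (s := q) (b := s * (4 / Real.pi ^ 2))
    (by have := q.cast_nonneg (α := ℝ); linarith) two_pos hb).congr_fun (fun θ _ => ?_)
    measurableSet_Ioi
  simp only [momentWeight, Real.rpow_natCast, Real.rpow_two]
  congr 2; ring

theorem exists_momentWeight_bound (q : ℕ) : ∃ C, 0 < C ∧ ∀ s, 0 < s →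
    ∫ θ in Ioi (0 : ℝ), momentWeight q s θ = C * s ^ (-((q : ℝ) + 1) / 2) := by
  have hpi := Real.pi_pos
  refine ⟨(4 / Real.pi ^ 2) ^ (-((q : ℝ) + 1) / 2) * (1 / 2) * Real.Gamma (((q : ℝ) + 1) / 2), ?_,
    fun s hs => ?_⟩
  · have : 0 < Real.Gamma (((q : ℝ) + 1) / 2) := Real.Gamma_pos_of_pos (by positivity)
    positivity
  · have h := integral_rpow_mul_exp_neg_mul_rpow (p := 2) (q := q) (b := s * (4 / Real.pi ^ 2))
      two_pos (by have := q.cast_nonneg (α := ℝ); linarith) (by positivity)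
    rw [Real.mul_rpow hs.le (by positivity)] at h
    rw [show ∀ A B D F : ℝ, A * B * D * F = F * A * B * D by intros; ring, ← h]
    refine setIntegral_congr_fun measurableSet_Ioi fun θ _ => ?_
    simp only [momentWeight, Real.rpow_natCast, Real.rpow_two]
    congr 2; ring

theorem setIntegral_momentWeight_le {q : ℕ} {s : ℝ} (hs : 0 < s) {t : Set ℝ} (ht : t ⊆ Ioi 0) :
    ∫ θ in t, momentWeight q s θ ≤ ∫ θ in Ioi (0 : ℝ), momentWeight q s θ :=
  setIntegral_mono_set (integrableOn_momentWeight q hs)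
    ((ae_restrict_iff' measurableSet_Ioi).2 (Eventually.of_forall fun _ hθ =>
      momentWeight_nonneg q s (le_of_lt hθ))) ht.eventuallyLE

theorem integral_momentWeight_le {q : ℕ} {s : ℝ} (hs : 0 < s) :
    ∫ θ in (0 : ℝ)..Real.pi, momentWeight q s θ ≤ ∫ θ in Ioi (0 : ℝ), momentWeight q s θ := by
  rw [intervalIntegral.integral_of_le Real.pi_pos.le]
  exact setIntegral_momentWeight_le hs Ioc_subset_Ioi_self

theorem exp_symbol_le {s θ : ℝ} (hs : 0 ≤ s) (h0 : 0 ≤ θ) (hθ : θ ≤ Real.pi) :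
    Real.exp (-s * symbol θ) ≤ Real.exp (-s * (4 / Real.pi ^ 2 * θ ^ 2)) := by
  have := mul_le_mul_of_nonneg_left (mul_sq_le_symbol (abs_le.2 ⟨by linarith, hθ⟩)) hs
  exact Real.exp_le_exp.2 (by linarith)

theorem exists_heatKer_le :
    ∃ C, 0 < C ∧ ∀ m : ℤ, ∀ s, 0 < s → heatKer m s ≤ C * s ^ (-1 / 2 : ℝ) := by
  obtain ⟨C, hC, h⟩ := exists_momentWeight_bound 0
  have hsym := continuous_symbol
  refine ⟨1 / Real.pi * C, by positivity, fun m s hs => ?_⟩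
  have h1 : ∫ θ in (0 : ℝ)..Real.pi, Real.exp (-s * symbol θ) * Real.cos ((m : ℝ) * θ) ≤
      ∫ θ in (0 : ℝ)..Real.pi, momentWeight 0 s θ := by
    refine intervalIntegral.integral_mono_on Real.pi_pos.le
      (by apply Continuous.intervalIntegrable; fun_prop)
      ((continuous_momentWeight 0 s).intervalIntegrable _ _) fun θ hθ => ?_
    rw [momentWeight, pow_zero, one_mul]
    exact (mul_le_of_le_one_right (Real.exp_pos _).le (Real.cos_le_one _)).trans
      (exp_symbol_le hs.le hθ.1 hθ.2)
  have h2 := h s hs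
  norm_num at h2
  rw [heatKer, mul_assoc]
  refine mul_le_mul_of_nonneg_left ((h1.trans (integral_momentWeight_le hs)).trans ?_)
    (by positivity)
  rw [h2]; norm_num

theorem exists_abs_lap_heatKer_le :
    ∃ C, 0 < C ∧ ∀ m : ℤ, ∀ s, 0 < s → |lap heatKer m s| ≤ C * s ^ (-3 / 2 : ℝ) := by
  obtain ⟨C, hC, h⟩ := exists_momentWeight_bound 2
  refine ⟨1 / Real.pi * C, by positivity, fun m s hs => ?_⟩
  have h1 : ‖∫ θ in (0 : ℝ)..Real.pi,
      Real.exp (-s * symbol θ) * (-symbol θ * Real.cos ((m : ℝ) * θ))‖ ≤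
      ∫ θ in (0 : ℝ)..Real.pi, momentWeight 2 s θ := by
    refine intervalIntegral.norm_integral_le_of_norm_le Real.pi_pos.le
      (Eventually.of_forall fun θ hθ => ?_)
      ((continuous_momentWeight 2 s).intervalIntegrable _ _)
    rw [Real.norm_eq_abs, abs_mul, abs_mul, abs_neg, abs_of_nonneg (symbol_nonneg θ),
      abs_of_pos (Real.exp_pos _), momentWeight, mul_comm]
    refine mul_le_mul ?_ (exp_symbol_le hs.le hθ.1.le hθ.2) (Real.exp_pos _).le (sq_nonneg θ)
    exact (mul_le_of_le_one_right (symbol_nonneg θ) (Real.abs_cos_le_one _)).trans (symbol_le_sq θ)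
  have h2 := h s hs
  norm_num at h2
  rw [lap_heatKer, abs_mul, abs_of_pos (by have := Real.pi_pos; positivity), mul_assoc]
  refine mul_le_mul_of_nonneg_left ((h1.trans (integral_momentWeight_le hs)).trans ?_)
    (by have := Real.pi_pos; positivity)
  rw [h2]; norm_num

/-- A Fourier integral whose integrand dominates `θ^q` up to the scale `s^{-1/2}` is at least of
the order `s^{-(q+1)/2}`. -/
theorem le_integral_exp_symbol {q : ℕ} {s b : ℝ} (hs : 1 ≤ s) {g : ℝ → ℝ} (hg : Continuous g)
    (hb : 0 ≤ b) (h0 : ∀ θ ∈ Icc 0 Real.pi, b * θ ^ q ≤ g θ) :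
    b * Real.exp (-1) / (q + 1) * s ^ (-((q : ℝ) + 1) / 2) ≤
      ∫ θ in (0 : ℝ)..Real.pi, Real.exp (-s * symbol θ) * g θ := by
  have hs0 : 0 < s := by linarith
  have hsym := continuous_symbol
  set δ : ℝ := s ^ (-1 / 2 : ℝ) with hδ
  have hδ0 : 0 < δ := Real.rpow_pos_of_pos hs0 _
  have hδ2 : s * δ ^ 2 = 1 := by
    rw [hδ, ← Real.rpow_natCast, ← Real.rpow_mul hs0.le]
    norm_num
    rw [Real.rpow_neg_one, mul_inv_cancel₀ hs0.ne']
  have hδ1 : δ ≤ 1 := Real.rpow_le_one_of_one_le_of_nonpos hs (by norm_num)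
  have hδpi : δ ≤ Real.pi := by linarith [Real.pi_gt_three]
  have hpow : δ ^ (q + 1) = s ^ (-((q : ℝ) + 1) / 2) := by
    rw [hδ, ← Real.rpow_natCast, ← Real.rpow_mul hs0.le]
    congr 1; push_cast; ring
  have hc : Continuous fun θ => Real.exp (-s * symbol θ) * g θ := by fun_prop
  have hnn : ∀ θ ∈ Icc 0 Real.pi, 0 ≤ g θ := fun θ hθ =>
    (mul_nonneg hb (pow_nonneg hθ.1 q)).trans (h0 θ hθ)
  calc b * Real.exp (-1) / (q + 1) * s ^ (-((q : ℝ) + 1) / 2)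
      = ∫ θ in (0 : ℝ)..δ, b * Real.exp (-1) * θ ^ q := by
        rw [intervalIntegral.integral_const_mul, integral_pow, ← hpow]
        simp; ring
    _ ≤ ∫ θ in (0 : ℝ)..δ, Real.exp (-s * symbol θ) * g θ := by
        refine intervalIntegral.integral_mono_on hδ0.le
          (by apply Continuous.intervalIntegrable; fun_prop) (hc.intervalIntegrable _ _)
          fun θ hθ => ?_
        have hθ' : θ ∈ Icc 0 Real.pi := ⟨hθ.1, hθ.2.trans hδpi⟩
        have h1 : s * symbol θ ≤ 1 := by
          rw [← hδ2]
          refine mul_le_mul_of_nonneg_left ((symbol_le_sq θ).trans ?_) hs0.le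
          exact pow_le_pow_left₀ hθ.1 hθ.2 2
        calc b * Real.exp (-1) * θ ^ q = Real.exp (-1) * (b * θ ^ q) := by ring
          _ ≤ Real.exp (-s * symbol θ) * g θ := by
            refine mul_le_mul (Real.exp_le_exp.2 (by linarith)) (h0 θ hθ')
              (mul_nonneg hb (pow_nonneg hθ.1 q)) (Real.exp_pos _).le
    _ ≤ ∫ θ in (0 : ℝ)..Real.pi, Real.exp (-s * symbol θ) * g θ := by
        refine intervalIntegral.integral_mono_interval le_rfl hδ0.le hδpi ?_
          (hc.intervalIntegrable _ _)
        exact (ae_restrict_iff' measurableSet_Ioc).2 (Eventually.of_forall fun θ hθ =>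
          mul_nonneg (Real.exp_pos _).le (hnn θ (Ioc_subset_Icc_self hθ)))

theorem exists_le_heatKer_zero :
    ∃ b, 0 < b ∧ ∀ s, 1 ≤ s → b * s ^ (-1 / 2 : ℝ) ≤ heatKer 0 s := by
  have hpi := Real.pi_pos
  refine ⟨1 / Real.pi * Real.exp (-1), by positivity, fun s hs => ?_⟩
  have h := le_integral_exp_symbol (q := 0) (b := 1) hs (g := fun _ => 1) continuous_const
    zero_le_one (fun θ _ => by simp)
  norm_num at h
  rw [heatKer, mul_assoc]
  refine mul_le_mul_of_nonneg_left ?_ (by positivity)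
  rw [show (-1 / 2 : ℝ) = -2⁻¹ by norm_num]
  simpa using h

/-- The heat kernel at a fixed node decays in time at the rate `s^{-3/2}` once `s` is large
compared with the square of the distance from the origin. -/
theorem exists_le_neg_lap_heatKer : ∃ b C, 0 < b ∧ 0 < C ∧ ∀ m : ℤ, ∀ s, 1 ≤ s →
    b * s ^ (-3 / 2 : ℝ) - C * (m : ℝ) ^ 2 * s ^ (-5 / 2 : ℝ) ≤ -lap heatKer m s := by
  obtain ⟨C, hC, h⟩ := exists_momentWeight_bound 4
  have hpi := Real.pi_pos
  have hsym := continuous_symbol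
  refine ⟨1 / Real.pi * (4 / Real.pi ^ 2 * Real.exp (-1) / 3), 1 / Real.pi * C, by positivity,
    by positivity, fun m s hs => ?_⟩
  have hs0 : 0 < s := by linarith
  have h1 := le_integral_exp_symbol (q := 2) (b := 4 / Real.pi ^ 2) hs (g := symbol) hsym
    (by positivity) (fun θ hθ => mul_sq_le_symbol (abs_le.2 ⟨by linarith [hθ.1], hθ.2⟩))
  have h2 := h s hs0
  have hi1 :
      IntervalIntegrable (fun θ => Real.exp (-s * symbol θ) * symbol θ) volume 0 Real.pi := by
    apply Continuous.intervalIntegrable; fun_prop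
  have hi2 := ((continuous_momentWeight 4 s).intervalIntegrable 0 Real.pi (μ := volume)).const_mul
    ((m : ℝ) ^ 2)
  have h3 : (∫ θ in (0 : ℝ)..Real.pi, Real.exp (-s * symbol θ) * symbol θ) -
      (m : ℝ) ^ 2 * ∫ θ in (0 : ℝ)..Real.pi, momentWeight 4 s θ ≤
      ∫ θ in (0 : ℝ)..Real.pi, -(Real.exp (-s * symbol θ) *
        (-symbol θ * Real.cos ((m : ℝ) * θ))) := by
    rw [← intervalIntegral.integral_const_mul, ← intervalIntegral.integral_sub hi1 hi2]
    refine intervalIntegral.integral_mono_on hpi.le (hi1.sub hi2)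
      (by apply Continuous.intervalIntegrable; fun_prop) fun θ hθ => ?_
    have e1 : 1 - Real.cos ((m : ℝ) * θ) ≤ (m : ℝ) ^ 2 * θ ^ 2 := by
      have := Real.one_sub_sq_div_two_le_cos (x := (m : ℝ) * θ)
      rw [mul_pow] at this
      nlinarith [mul_nonneg (sq_nonneg (m : ℝ)) (sq_nonneg θ)]
    have e2 : Real.exp (-s * symbol θ) * symbol θ * (1 - Real.cos ((m : ℝ) * θ)) ≤
        Real.exp (-s * (4 / Real.pi ^ 2 * θ ^ 2)) * θ ^ 2 * ((m : ℝ) ^ 2 * θ ^ 2) := by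
      refine mul_le_mul (mul_le_mul (exp_symbol_le hs0.le hθ.1 hθ.2) (symbol_le_sq θ)
        (symbol_nonneg θ) (Real.exp_pos _).le) e1 (by linarith [Real.cos_le_one ((m : ℝ) * θ)])
        (by positivity)
    simp only [momentWeight]
    nlinarith
  rw [intervalIntegral.integral_neg] at h3
  have h4 : (m : ℝ) ^ 2 * ∫ θ in (0 : ℝ)..Real.pi, momentWeight 4 s θ ≤
      (m : ℝ) ^ 2 * (C * s ^ (-5 / 2 : ℝ)) := by
    refine mul_le_mul_of_nonneg_left ((integral_momentWeight_le hs0).trans ?_) (sq_nonneg _)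
    rw [h2]; norm_num
  rw [show -(((2 : ℕ) : ℝ) + 1) / 2 = -3 / 2 by norm_num,
    show ((2 : ℕ) : ℝ) + 1 = 3 by norm_num] at h1
  rw [lap_heatKer, ← mul_neg]
  have h5 : 4 / Real.pi ^ 2 * Real.exp (-1) / 3 * s ^ (-3 / 2 : ℝ) -
      (m : ℝ) ^ 2 * (C * s ^ (-5 / 2 : ℝ)) ≤ -∫ θ in (0 : ℝ)..Real.pi,
        Real.exp (-s * symbol θ) * (-symbol θ * Real.cos ((m : ℝ) * θ)) := by
    linarith
  have h6 := mul_le_mul_of_nonneg_left h5 (by positivity : 0 ≤ 1 / Real.pi)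
  refine le_trans (le_of_eq ?_) h6
  ring

/-! ### The Gaussian tail -/

/-- The Gaussian tail `π^{-1/2} ∫_x^∞ exp (-u²) du`, half the complementary error function. -/
noncomputable def gaussTail (x : ℝ) : ℝ :=
  1 / 2 - (1 / √Real.pi) * ∫ u in (0 : ℝ)..x, Real.exp (-u ^ 2)

theorem gaussTail_zero : gaussTail 0 = 1 / 2 := by simp [gaussTail]

theorem hasDerivAt_gaussTail (x : ℝ) :
    HasDerivAt gaussTail (-(1 / √Real.pi * Real.exp (-x ^ 2))) x := by
  have hc : Continuous fun u : ℝ => Real.exp (-u ^ 2) := by fun_prop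
  have h := ((hc.integral_hasStrictDerivAt 0 x).hasDerivAt.const_mul (1 / √Real.pi)).const_sub
    (1 / 2)
  exact h

theorem gaussTail_antitone : Antitone gaussTail :=
  antitone_of_hasDerivAt_nonpos hasDerivAt_gaussTail fun x => by
    have : 0 ≤ 1 / √Real.pi * Real.exp (-x ^ 2) := by positivity
    simpa using this

theorem tendsto_gaussTail : Tendsto gaussTail atTop (𝓝 0) := by
  have hg : IntegrableOn (fun u : ℝ => Real.exp (-1 * u ^ 2)) (Ioi 0) :=
    (integrable_exp_neg_mul_sq one_pos).integrableOn
  have h1 := intervalIntegral_tendsto_integral_Ioi 0 hg tendsto_id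
  rw [integral_gaussian_Ioi, div_one] at h1
  have h2 := (h1.const_mul (1 / √Real.pi)).const_sub (1 / 2)
  have hpi : √Real.pi ≠ 0 := (Real.sqrt_pos.2 Real.pi_pos).ne'
  have e : (1 : ℝ) / 2 - 1 / √Real.pi * (√Real.pi / 2) = 0 := by field_simp; norm_num
  rw [e] at h2
  refine h2.congr fun x => ?_
  simp only [gaussTail, neg_mul, one_mul, id]

theorem gaussTail_nonneg (x : ℝ) : 0 ≤ gaussTail x :=
  gaussTail_antitone.le_of_tendsto tendsto_gaussTail x

theorem gaussTail_le_half {x : ℝ} (hx : 0 ≤ x) : gaussTail x ≤ 1 / 2 :=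
  (gaussTail_antitone hx).trans gaussTail_zero.le

/-- The Gaussian tail is Lipschitz with respect to the logarithm of its argument. -/
theorem gaussTail_le_add {x y ε : ℝ} (hε : 0 ≤ ε) (hx : 0 ≤ x) (hxy : x ≤ y)
    (hy : y ≤ x * (1 + ε)) : gaussTail x ≤ gaussTail y + ε := by
  have hc : Continuous fun u : ℝ => Real.exp (-u ^ 2) := by fun_prop
  have h1 : ∫ u in x..y, Real.exp (-u ^ 2) ≤ ∫ u in x..y, Real.exp (-x ^ 2) :=
    intervalIntegral.integral_mono_on hxy (hc.intervalIntegrable _ _) intervalIntegrable_const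
      fun u hu => Real.exp_le_exp.2 (neg_le_neg (pow_le_pow_left₀ hx hu.1 2))
  rw [intervalIntegral.integral_const, smul_eq_mul] at h1
  have h2 : x * Real.exp (-x ^ 2) ≤ 1 := by
    rw [Real.exp_neg, ← div_eq_mul_inv, div_le_one (Real.exp_pos _)]
    nlinarith [Real.add_one_le_exp (x ^ 2), sq_nonneg (x - 1)]
  have h0 : (y - x) * Real.exp (-x ^ 2) ≤ ε :=
    calc (y - x) * Real.exp (-x ^ 2) ≤ (x * ε) * Real.exp (-x ^ 2) :=
          mul_le_mul_of_nonneg_right (by linarith) (Real.exp_pos _).le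
      _ = ε * (x * Real.exp (-x ^ 2)) := by ring
      _ ≤ ε * 1 := mul_le_mul_of_nonneg_left h2 hε
      _ = ε := mul_one ε
  have h3 : 1 / √Real.pi ≤ 1 := by
    rw [div_le_one (Real.sqrt_pos.2 Real.pi_pos)]
    exact Real.one_le_sqrt.2 (by linarith [Real.pi_gt_three])
  have h4 : 0 ≤ ∫ u in x..y, Real.exp (-u ^ 2) :=
    intervalIntegral.integral_nonneg hxy fun _ _ => (Real.exp_pos _).le
  have h5 : gaussTail x = gaussTail y + 1 / √Real.pi * ∫ u in x..y, Real.exp (-u ^ 2) := by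
    simp only [gaussTail]
    rw [← intervalIntegral.integral_add_adjacent_intervals (hc.intervalIntegrable 0 x)
      (hc.intervalIntegrable x y)]
    ring
  rw [h5]
  have h6 := mul_le_mul_of_nonneg_right h3 h4
  linarith

theorem integrable_exp_mul_cos {s : ℝ} (hs : 0 < s) (x : ℝ) :
    Integrable fun θ : ℝ => Real.exp (-s * θ ^ 2) * Real.cos (x * θ) := by
  refine (integrable_exp_neg_mul_sq hs).mono' (by fun_prop) (Eventually.of_forall fun θ => ?_)
  rw [Real.norm_eq_abs, abs_mul, abs_of_pos (Real.exp_pos _)]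
  exact mul_le_of_le_one_right (Real.exp_pos _).le (Real.abs_cos_le_one _)

/-- The Gaussian is its own Fourier transform, in real form on the half-line. -/
theorem integral_exp_mul_cos {s : ℝ} (hs : 0 < s) (x : ℝ) :
    ∫ θ in Ioi (0 : ℝ), Real.exp (-s * θ ^ 2) * Real.cos (x * θ) =
      √(Real.pi / s) / 2 * Real.exp (-(x ^ 2) / (4 * s)) := by
  have h := fourierIntegral_gaussian (b := (s : ℂ)) (by simpa using hs) x
  have h2 := congrArg Complex.re h
  have hint : Integrable fun θ : ℝ =>
      Complex.exp (Complex.I * x * θ) * Complex.exp (-(s : ℂ) * (θ : ℂ) ^ 2) := by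
    refine (integrable_exp_neg_mul_sq hs).mono' (by fun_prop) (Eventually.of_forall fun θ => ?_)
    rw [norm_mul, Complex.norm_exp, Complex.norm_exp]
    simp [← Complex.ofReal_pow]
  have h3 : ∫ θ : ℝ, Real.exp (-s * θ ^ 2) * Real.cos (x * θ) =
      (∫ θ : ℝ, Complex.exp (Complex.I * x * θ) * Complex.exp (-(s : ℂ) * (θ : ℂ) ^ 2)).re := by
    rw [← RCLike.re_eq_complex_re, ← integral_re hint]
    refine integral_congr_ae (Eventually.of_forall fun θ => ?_)
    have e1 : Complex.exp (-(s : ℂ) * (θ : ℂ) ^ 2) = ((Real.exp (-s * θ ^ 2) : ℝ) : ℂ) := by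
      push_cast; rfl
    have e2 : Complex.I * x * θ = ((x * θ : ℝ) : ℂ) * Complex.I := by push_cast; ring
    simp only [e1, e2, RCLike.re_eq_complex_re, Complex.re_mul_ofReal, Complex.exp_ofReal_mul_I_re]
    ring
  have h4 := integral_comp_abs (f := fun θ : ℝ => Real.exp (-s * θ ^ 2) * Real.cos (x * θ))
  have h5 : ∀ θ : ℝ, Real.exp (-s * |θ| ^ 2) * Real.cos (x * |θ|) =
      Real.exp (-s * θ ^ 2) * Real.cos (x * θ) := fun θ => by
    rw [sq_abs]
    rcases abs_cases θ with ⟨h, _⟩ | ⟨h, _⟩ <;> rw [h]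
    rw [mul_neg, Real.cos_neg]
  simp only [h5] at h4
  have h6 : ((Real.pi / s : ℂ) ^ (1 / 2 : ℂ) * Complex.exp (-(x : ℂ) ^ 2 / (4 * s))).re =
      √(Real.pi / s) * Real.exp (-(x ^ 2) / (4 * s)) := by
    have e1 : (Real.pi / s : ℂ) ^ (1 / 2 : ℂ) = ((√(Real.pi / s) : ℝ) : ℂ) := by
      rw [Real.sqrt_eq_rpow, Complex.ofReal_cpow (by have := Real.pi_pos; positivity)]
      push_cast; rfl
    have e2 : Complex.exp (-(x : ℂ) ^ 2 / (4 * s)) = ((Real.exp (-(x ^ 2) / (4 * s)) : ℝ) : ℂ) := by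
      push_cast; rfl
    rw [e1, e2, ← Complex.ofReal_mul, Complex.ofReal_re]
  rw [← h3, h4, h6] at h2
  linarith

theorem abs_sin_div_le (x : ℝ) {θ : ℝ} (hθ : 0 < θ) : |Real.sin (x * θ) / θ| ≤ |x| := by
  rw [abs_div, abs_of_pos hθ, div_le_iff₀ hθ]
  calc |Real.sin (x * θ)| ≤ |x * θ| := Real.abs_sin_le_abs
    _ = |x| * θ := by rw [abs_mul, abs_of_pos hθ]

theorem integrableOn_exp_mul_sin_div {s : ℝ} (hs : 0 < s) (x : ℝ) :
    IntegrableOn (fun θ : ℝ => Real.exp (-s * θ ^ 2) * (Real.sin (x * θ) / θ)) (Ioi 0) := by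
  refine ((integrable_exp_neg_mul_sq hs).integrableOn.mul_const |x|).mono' ?_ ?_
  · exact Measurable.aestronglyMeasurable (by fun_prop)
  · refine (ae_restrict_iff' measurableSet_Ioi).2 (Eventually.of_forall fun θ hθ => ?_)
    rw [Real.norm_eq_abs, abs_mul, abs_of_pos (Real.exp_pos _)]
    exact mul_le_mul_of_nonneg_left (abs_sin_div_le x hθ) (Real.exp_pos _).le

/-- Fourier representation of the Gaussian tail. -/
theorem integral_exp_mul_sin_div {s : ℝ} (hs : 0 < s) (x : ℝ) :
    (1 / Real.pi) * ∫ θ in Ioi (0 : ℝ), Real.exp (-s * θ ^ 2) * (Real.sin (x * θ) / θ) =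
      1 / 2 - gaussTail (x / (2 * √s)) := by
  have hpi := Real.pi_pos
  have hd1 : ∀ x, HasDerivAt
      (fun x => ∫ θ in Ioi (0 : ℝ), Real.exp (-s * θ ^ 2) * (Real.sin (x * θ) / θ))
      (√(Real.pi / s) / 2 * Real.exp (-(x ^ 2) / (4 * s))) x := by
    intro x
    rw [← integral_exp_mul_cos hs]
    refine (hasDerivAt_integral_of_dominated_loc_of_deriv_le
      (μ := volume.restrict (Ioi 0))
      (F := fun x θ => Real.exp (-s * θ ^ 2) * (Real.sin (x * θ) / θ))
      (F' := fun x θ => Real.exp (-s * θ ^ 2) * Real.cos (x * θ))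
      (bound := fun θ => Real.exp (-s * θ ^ 2)) univ_mem ?_
      (integrableOn_exp_mul_sin_div hs x) ?_ ?_ ?_ ?_).2
    · exact Eventually.of_forall fun x => (integrableOn_exp_mul_sin_div hs x).aestronglyMeasurable
    · exact (integrable_exp_mul_cos hs x).integrableOn.aestronglyMeasurable
    · refine Eventually.of_forall fun θ x _ => ?_
      rw [Real.norm_eq_abs, abs_mul, abs_of_pos (Real.exp_pos _)]
      exact mul_le_of_le_one_right (Real.exp_pos _).le (Real.abs_cos_le_one _)
    · exact (integrable_exp_neg_mul_sq hs).integrableOn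
    · refine (ae_restrict_iff' measurableSet_Ioi).2 (Eventually.of_forall fun θ hθ x _ => ?_)
      have h1 : HasDerivAt (fun x : ℝ => Real.sin (x * θ)) (Real.cos (x * θ) * (1 * θ)) x :=
        ((hasDerivAt_id x).mul_const θ).sin
      refine ((h1.div_const θ).const_mul _).congr_deriv ?_
      have : θ ≠ 0 := (ne_of_gt hθ)
      field_simp
  have hd2 : ∀ x, HasDerivAt (fun x => Real.pi * (1 / 2 - gaussTail (x / (2 * √s))))
      (√(Real.pi / s) / 2 * Real.exp (-(x ^ 2) / (4 * s))) x := by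
    intro x
    have h1 := (hasDerivAt_gaussTail (x / (2 * √s))).comp x ((hasDerivAt_id x).div_const (2 * √s))
    refine ((h1.const_sub (1 / 2)).const_mul Real.pi).congr_deriv ?_
    have h2 : (x / (2 * √s)) ^ 2 = x ^ 2 / (4 * s) := by
      rw [div_pow, mul_pow, Real.sq_sqrt hs.le]; norm_num
    rw [h2, Real.sqrt_div hpi.le, neg_div]
    have h3 : √Real.pi ≠ 0 := (Real.sqrt_pos.2 hpi).ne'
    have h4 : √s ≠ 0 := (Real.sqrt_pos.2 hs).ne'
    have h5 : Real.pi = √Real.pi * √Real.pi := (Real.mul_self_sqrt hpi.le).symm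
    field_simp
    nth_rewrite 1 [h5]
    ring
  have hconst := is_const_of_deriv_eq_zero
    (f := fun x => (∫ θ in Ioi (0 : ℝ), Real.exp (-s * θ ^ 2) * (Real.sin (x * θ) / θ)) -
      Real.pi * (1 / 2 - gaussTail (x / (2 * √s))))
    (fun x => ((hd1 x).sub (hd2 x)).differentiableAt)
    (fun x => ((hd1 x).sub (hd2 x)).deriv.trans (sub_self _)) x 0
  simp only [zero_mul, Real.sin_zero, zero_div, mul_zero, integral_zero, gaussTail_zero,
    sub_self] at hconst
  rw [sub_eq_zero.1 hconst]
  field_simp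

/-! ### Comparison of the lattice tail with the Gaussian tail -/

/-- Dirichlet kernel. -/
theorem two_sin_mul_dirichlet (m : ℕ) (θ : ℝ) :
    (1 / 2 + ∑ j ∈ Finset.range m, Real.cos (((j : ℝ) + 1) * θ)) * (2 * Real.sin (θ / 2)) =
      Real.sin (((m : ℝ) + 1 / 2) * θ) := by
  induction m with
  | zero => simp; ring_nf
  | succ m ih =>
    rw [Finset.sum_range_succ, ← add_assoc, add_mul, ih]
    push_cast
    have e1 : ((m : ℝ) + 1 / 2) * θ = ((m : ℝ) + 1) * θ - θ / 2 := by ring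
    have e2 : ((m : ℝ) + 1 + 1 / 2) * θ = ((m : ℝ) + 1) * θ + θ / 2 := by ring
    rw [e1, e2, Real.sin_sub, Real.sin_add]
    ring

theorem latticeTail_eq_sum (m : ℕ) {s : ℝ} (hs : 0 ≤ s) :
    latticeTail m s =
      1 / 2 - (heatKer 0 s / 2 + ∑ j ∈ Finset.range m, heatKer ((j : ℤ) + 1) s) := by
  induction m with
  | zero => simp [latticeTail_zero hs]
  | succ m ih =>
    push_cast
    rw [latticeTail_succ (by positivity) hs, ih, Finset.sum_range_succ]
    ring

/-- Fourier representation of the lattice tail, with the Dirichlet kernel in the place of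
`sin (x θ) / θ`. -/
theorem latticeTail_eq_fourier (m : ℕ) {s : ℝ} (hs : 0 ≤ s) :
    latticeTail m s = 1 / 2 - (1 / Real.pi) * ∫ θ in Ioc (0 : ℝ) Real.pi,
      Real.exp (-s * symbol θ) * (1 / 2 + ∑ j ∈ Finset.range m, Real.cos (((j : ℝ) + 1) * θ)) := by
  have hsym := continuous_symbol
  rw [latticeTail_eq_sum m hs, ← intervalIntegral.integral_of_le Real.pi_pos.le]
  congr 1
  simp only [mul_add, Finset.mul_sum]
  rw [intervalIntegral.integral_add (by apply Continuous.intervalIntegrable; fun_prop)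
    (by apply Continuous.intervalIntegrable; fun_prop), intervalIntegral.integral_finsetSum
    (fun j _ => by apply Continuous.intervalIntegrable; fun_prop), mul_add, Finset.mul_sum,
    intervalIntegral.integral_mul_const]
  simp [heatKer]
  ring

/-- Pointwise comparison of the Fourier integrands of the lattice and the continuum tails. -/
theorem abs_fourier_sub_le {s x d θ : ℝ} (hs : 0 < s) (h0 : 0 < θ) (hθ : θ ≤ Real.pi)
    (hd : d * (2 * Real.sin (θ / 2)) = Real.sin (x * θ)) :
    |Real.exp (-s * θ ^ 2) * (Real.sin (x * θ) / θ) - Real.exp (-s * symbol θ) * d| ≤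
      s * momentWeight 3 s θ + momentWeight 1 s θ := by
  have hpi := Real.pi_pos
  set σ : ℝ := 2 * Real.sin (θ / 2) with hσ
  have hσle : σ ≤ θ := by
    have := Real.sin_le (x := θ / 2) (by linarith)
    linarith
  have hσge : 2 / Real.pi * θ ≤ σ := by
    have := Real.mul_le_sin (x := θ / 2) (by linarith) (by linarith)
    have e : 2 / Real.pi * θ = 2 * (2 / Real.pi * (θ / 2)) := by ring
    linarith
  have hσcube : θ - σ ≤ θ ^ 3 / 4 := by
    have := Real.sin_ge_sub_cube (x := θ / 2) (by linarith)
    have e : (θ / 2) ^ 3 / 6 * 2 ≤ θ ^ 3 / 4 := by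
      have := pow_pos h0 3
      nlinarith
    linarith
  have hσpos : 0 < σ := lt_of_lt_of_le (by positivity) hσge
  have hsym : symbol θ = σ ^ 2 := by
    rw [hσ, symbol, mul_pow, Real.sin_sq_eq_half_sub]
    ring_nf
  set X := Real.exp (-s * (4 / Real.pi ^ 2 * θ ^ 2)) with hX
  have hX0 : 0 < X := Real.exp_pos _
  have hsX : Real.exp (-s * symbol θ) ≤ X := exp_symbol_le hs.le h0.le hθ
  have hsin : |Real.sin (x * θ)| ≤ 1 := Real.abs_sin_le_one _
  have hdeq : d = Real.sin (x * θ) / σ := by rw [← hd]; field_simp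
  -- The error of replacing the Gaussian by `exp (-s symbol)`.
  have hA : |Real.exp (-s * θ ^ 2) - Real.exp (-s * symbol θ)| ≤ s * θ ^ 4 * X := by
    have hle : s * symbol θ ≤ s * θ ^ 2 := mul_le_mul_of_nonneg_left (symbol_le_sq θ) hs.le
    rw [abs_sub_comm, abs_of_nonneg (sub_nonneg.2 (Real.exp_le_exp.2 (by linarith)))]
    have h1 : Real.exp (-s * θ ^ 2) =
        Real.exp (-s * symbol θ) * Real.exp (-(s * (θ ^ 2 - symbol θ))) := by
      rw [← Real.exp_add]; ring_nf
    have h2 := Real.add_one_le_exp (-(s * (θ ^ 2 - symbol θ)))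
    have h3 : θ ^ 2 - symbol θ ≤ θ ^ 4 := by
      rw [hsym]
      have : θ ^ 2 - σ ^ 2 = (θ - σ) * (θ + σ) := by ring
      rw [this]
      calc (θ - σ) * (θ + σ) ≤ θ ^ 3 / 4 * (2 * θ) :=
            mul_le_mul hσcube (by linarith) (by linarith) (by positivity)
        _ ≤ θ ^ 4 := by nlinarith [pow_pos h0 4]
    have h4 : 0 ≤ θ ^ 2 - symbol θ := by linarith [symbol_le_sq θ]
    calc Real.exp (-s * symbol θ) - Real.exp (-s * θ ^ 2)
        ≤ Real.exp (-s * symbol θ) * (s * (θ ^ 2 - symbol θ)) := by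
          rw [h1]; nlinarith [Real.exp_pos (-s * symbol θ)]
      _ ≤ X * (s * θ ^ 4) := by gcongr
      _ = _ := by ring
  -- The error of replacing `1 / θ` by `1 / (2 sin (θ / 2))`.
  have hB : |1 / θ - 1 / σ| ≤ θ := by
    have e : 1 / θ - 1 / σ = -((θ - σ) / (θ * σ)) := by field_simp; ring
    rw [e, abs_neg, abs_of_nonneg (div_nonneg (by linarith) (by positivity)),
      div_le_iff₀ (by positivity)]
    have h1 : θ / 4 ≤ σ := by
      have : 1 / 4 ≤ 2 / Real.pi := by
        rw [div_le_div_iff₀ (by norm_num) hpi]; linarith [Real.pi_le_four]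
      nlinarith
    calc θ - σ ≤ θ ^ 3 / 4 := hσcube
      _ = θ * (θ * (θ / 4)) := by ring
      _ ≤ θ * (θ * σ) := by gcongr
  have hsplit : Real.exp (-s * θ ^ 2) * (Real.sin (x * θ) / θ) - Real.exp (-s * symbol θ) * d =
      ((Real.exp (-s * θ ^ 2) - Real.exp (-s * symbol θ)) / θ +
        Real.exp (-s * symbol θ) * (1 / θ - 1 / σ)) * Real.sin (x * θ) := by
    rw [hdeq]; field_simp; ring
  rw [hsplit, abs_mul]
  refine (mul_le_of_le_one_right (abs_nonneg _) hsin).trans ((abs_add_le _ _).trans ?_)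
  rw [abs_div, abs_of_pos h0, abs_mul, abs_of_pos (Real.exp_pos (-s * symbol θ))]
  refine add_le_add ?_ ?_
  · rw [div_le_iff₀ h0]
    refine hA.trans (le_of_eq ?_)
    simp only [momentWeight, ← hX]; ring
  · simp only [momentWeight, ← hX, pow_one]
    rw [mul_comm θ X]
    exact mul_le_mul hsX hB (abs_nonneg _) hX0.le

/-- The lattice tail agrees with the Gaussian tail at the midpoint `m + 1/2` up to `O(1/s)`,
uniformly in `m`. Only the upper bound is stated, with the midpoint relaxed to `m`. -/
theorem exists_latticeTail_le : ∃ C, 0 < C ∧ ∀ m : ℕ, ∀ s, 0 < s →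
    latticeTail m s ≤ gaussTail (m / (2 * √s)) + C / s := by
  obtain ⟨C1, hC1, h1⟩ := exists_momentWeight_bound 1
  obtain ⟨C3, hC3, h3⟩ := exists_momentWeight_bound 3
  have hpi := Real.pi_pos
  have hsym := continuous_symbol
  refine ⟨1 / Real.pi * (C3 + C1 + C1), by positivity, fun m s hs => ?_⟩
  set x : ℝ := (m : ℝ) + 1 / 2 with hx
  set A : ℝ → ℝ := fun θ => Real.exp (-s * θ ^ 2) * (Real.sin (x * θ) / θ) with hA
  set B : ℝ → ℝ := fun θ => Real.exp (-s * symbol θ) *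
    (1 / 2 + ∑ j ∈ Finset.range m, Real.cos (((j : ℝ) + 1) * θ)) with hB
  have hAint := integrableOn_exp_mul_sin_div hs x
  have hA1 : IntegrableOn A (Ioc 0 Real.pi) := hAint.mono_set Ioc_subset_Ioi_self
  have hA2 : IntegrableOn A (Ioi Real.pi) := hAint.mono_set (Ioi_subset_Ioi hpi.le)
  have hBint : IntegrableOn B (Ioc 0 Real.pi) := by
    have : Continuous B := by fun_prop
    exact (this.integrableOn_Icc).mono_set Ioc_subset_Icc_self
  have hw3 := integrableOn_momentWeight 3 hs
  have hw1 := integrableOn_momentWeight 1 hs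
  have hsplit : ∫ θ in Ioi (0 : ℝ), A θ =
      (∫ θ in Ioc 0 Real.pi, A θ) + ∫ θ in Ioi Real.pi, A θ := by
    rw [← setIntegral_union (Ioc_disjoint_Ioi le_rfl) measurableSet_Ioi hA1 hA2,
      Ioc_union_Ioi_eq_Ioi hpi.le]
  have hnear : |∫ θ in Ioc 0 Real.pi, (A θ - B θ)| ≤
      ∫ θ in Ioc 0 Real.pi, (s * momentWeight 3 s θ + momentWeight 1 s θ) := by
    refine norm_integral_le_of_norm_le (f := fun θ => A θ - B θ) ?_
      ((ae_restrict_iff' measurableSet_Ioc).2 (Eventually.of_forall fun θ hθ =>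
        abs_fourier_sub_le hs hθ.1 hθ.2 (two_sin_mul_dirichlet m θ)))
    exact IntegrableOn.mono_set ((hw3.const_mul s).add hw1) Ioc_subset_Ioi_self
  have htail : |∫ θ in Ioi Real.pi, A θ| ≤ ∫ θ in Ioi Real.pi, momentWeight 1 s θ := by
    refine norm_integral_le_of_norm_le (f := A) (hw1.mono_set (Ioi_subset_Ioi hpi.le))
      ((ae_restrict_iff' measurableSet_Ioi).2 (Eventually.of_forall fun θ hθ => ?_))
    have hθ1 : 1 ≤ θ := by have : Real.pi < θ := hθ; linarith [Real.pi_gt_three]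
    have hθ0 : 0 < θ := by linarith
    rw [Real.norm_eq_abs, hA, abs_mul, abs_of_pos (Real.exp_pos _), momentWeight, pow_one, mul_comm]
    refine mul_le_mul ?_ (Real.exp_le_exp.2 ?_) (Real.exp_pos _).le hθ0.le
    · rw [abs_div, abs_of_pos hθ0, div_le_iff₀ hθ0]
      nlinarith [Real.abs_sin_le_one (x * θ)]
    · have h4 : 4 / Real.pi ^ 2 ≤ 1 := by
        rw [div_le_one (by positivity)]; nlinarith [Real.pi_gt_three]
      have := mul_le_mul_of_nonneg_left
        (mul_le_mul_of_nonneg_right h4 (sq_nonneg θ)) hs.le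
      linarith
  rw [integral_sub hA1 hBint] at hnear
  rw [integral_add (IntegrableOn.mono_set (hw3.const_mul s) Ioc_subset_Ioi_self)
    (hw1.mono_set Ioc_subset_Ioi_self), integral_const_mul] at hnear
  have e3 : s * ∫ θ in Ioi (0 : ℝ), momentWeight 3 s θ = C3 / s := by
    rw [h3 s hs, show -(((3 : ℕ) : ℝ) + 1) / 2 = -2 by norm_num, Real.rpow_neg hs.le]
    norm_num
    field_simp
  have e1 : ∫ θ in Ioi (0 : ℝ), momentWeight 1 s θ = C1 / s := by
    rw [h1 s hs, show -(((1 : ℕ) : ℝ) + 1) / 2 = -1 by norm_num, Real.rpow_neg_one]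
    rfl
  have hsub : Ioc 0 Real.pi ⊆ Ioi (0 : ℝ) := fun _ h => h.1
  have b3 := mul_le_mul_of_nonneg_left (setIntegral_momentWeight_le (q := 3) hs hsub) hs.le
  have b1 := setIntegral_momentWeight_le (q := 1) hs hsub
  have b2 := setIntegral_momentWeight_le (q := 1) hs (Ioi_subset_Ioi hpi.le)
  have hmain : (∫ θ in Ioi (0 : ℝ), A θ) - ∫ θ in Ioc 0 Real.pi, B θ ≤ (C3 + C1 + C1) / s := by
    have k1 := (abs_le.1 hnear).2
    have k2 := (abs_le.1 htail).2
    have e : (C3 + C1 + C1) / s = C3 / s + C1 / s + C1 / s := by ring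
    rw [hsplit, e]
    linarith
  have hG := integral_exp_mul_sin_div hs x
  have hT := latticeTail_eq_fourier m hs.le
  have hanti : gaussTail (x / (2 * √s)) ≤ gaussTail (m / (2 * √s)) := by
    apply gaussTail_antitone
    gcongr
    linarith
  have h6 := mul_le_mul_of_nonneg_left hmain (by positivity : 0 ≤ 1 / Real.pi)
  have e : 1 / Real.pi * (C3 + C1 + C1) / s = 1 / Real.pi * ((C3 + C1 + C1) / s) := by ring
  rw [e]
  linarith

/-! ### The root condition -/

/-- Closed form of the source solution in terms of the Gaussian tail. -/
theorem green_eq {z s : ℝ} (hz : 0 < z) (hs : 0 < s) :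
    green z s = √(s / Real.pi) * Real.exp (-z ^ 2 / (4 * s)) - z * gaussTail (z / (2 * √s)) := by
  have hpi := Real.pi_pos
  have hspi : √Real.pi ≠ 0 := (Real.sqrt_pos.2 hpi).ne'
  set R : ℝ → ℝ := fun r =>
    √(r / Real.pi) * Real.exp (-z ^ 2 / (4 * r)) - z * gaussTail (z / (2 * √r)) with hR
  have hderiv : ∀ r, 0 < r →
      HasDerivAt R (Real.exp (-z ^ 2 / (4 * r)) / √(4 * Real.pi * r)) r := by
    intro r hr
    have hr' : √r ≠ 0 := (Real.sqrt_pos.2 hr).ne'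
    have h1 : HasDerivAt (fun r : ℝ => √(r / Real.pi)) (1 / Real.pi / (2 * √(r / Real.pi))) r :=
      ((hasDerivAt_id r).div_const Real.pi).sqrt (by simp only [id]; positivity)
    have h2 : HasDerivAt (fun r : ℝ => -z ^ 2 / (4 * r)) (z ^ 2 / (4 * r ^ 2)) r := by
      refine ((hasDerivAt_const r (-z ^ 2)).div ((hasDerivAt_id r).const_mul 4)
        (by simp only [id]; positivity)).congr_deriv ?_
      simp only [id]; field_simp; ring
    have h3 : HasDerivAt (fun r : ℝ => z / (2 * √r)) (-z / (4 * r * √r)) r := by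
      refine ((hasDerivAt_const r z).div ((Real.hasDerivAt_sqrt hr.ne').const_mul 2)
        (by positivity)).congr_deriv ?_
      field_simp
      rw [Real.sq_sqrt hr.le]
      ring
    have h4 := (h1.mul h2.exp).sub (((hasDerivAt_gaussTail (z / (2 * √r))).comp r h3).const_mul z)
    refine h4.congr_deriv ?_
    have e1 : -(z / (2 * √r)) ^ 2 = -z ^ 2 / (4 * r) := by
      rw [div_pow, mul_pow, Real.sq_sqrt hr.le]; ring
    have e2 : √(4 * Real.pi * r) = 2 * √Real.pi * √r := by
      rw [Real.sqrt_mul (by positivity), Real.sqrt_mul (by norm_num)]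
      congr 2
      rw [show (4 : ℝ) = 2 ^ 2 by norm_num, Real.sqrt_sq (by norm_num)]
    rw [e1, e2, Real.sqrt_div hr.le]
    have e3 : r = √r ^ 2 := (Real.sq_sqrt hr.le).symm
    have e4 : Real.pi = √Real.pi ^ 2 := (Real.sq_sqrt hpi.le).symm
    generalize Real.exp (-z ^ 2 / (4 * r)) = X
    generalize √r = q at *
    generalize √Real.pi = p at *
    rw [e3, e4]
    field_simp
    ring
  have hlim : Tendsto R (𝓝[>] 0) (𝓝 0) := by
    have h1 : Tendsto (fun r : ℝ => √(r / Real.pi)) (𝓝[>] 0) (𝓝 0) := by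
      have : Continuous fun r : ℝ => √(r / Real.pi) := by fun_prop
      simpa using (this.tendsto 0).mono_left nhdsWithin_le_nhds
    have h2 : Tendsto (fun r : ℝ => √(r / Real.pi) * Real.exp (-z ^ 2 / (4 * r)))
        (𝓝[>] 0) (𝓝 0) := by
      refine squeeze_zero' (Eventually.of_forall fun r => by positivity) ?_ h1
      filter_upwards [self_mem_nhdsWithin] with r (hr : 0 < r)
      refine mul_le_of_le_one_right (Real.sqrt_nonneg _) (Real.exp_le_one_iff.2 ?_)
      exact div_nonpos_of_nonpos_of_nonneg (by nlinarith) (by positivity)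
    have h3 : Tendsto (fun r : ℝ => z / (2 * √r)) (𝓝[>] 0) atTop := by
      refine Tendsto.const_mul_atTop' hz ?_ |>.congr fun r => (div_eq_mul_inv z (2 * √r)).symm
      refine tendsto_inv_nhdsGT_zero.comp (tendsto_nhdsWithin_iff.2 ⟨?_, ?_⟩)
      · have : Continuous fun r : ℝ => 2 * √r := by fun_prop
        simpa using (this.tendsto 0).mono_left nhdsWithin_le_nhds
      · filter_upwards [self_mem_nhdsWithin] with r (hr : 0 < r)
        have := Real.sqrt_pos.2 hr
        exact mem_Ioi.2 (by positivity)
    have h4 := h2.sub ((tendsto_gaussTail.comp h3).const_mul z)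
    simpa using h4
  have hint : IntervalIntegrable (fun r => Real.exp (-z ^ 2 / (4 * r)) / √(4 * Real.pi * r))
      volume 0 s := by
    have hm : IntervalIntegrable (fun r : ℝ => r ^ (-1 / 2 : ℝ)) volume 0 s :=
      intervalIntegral.intervalIntegrable_rpow' (by norm_num)
    refine hm.mono_fun' (Measurable.aestronglyMeasurable (by fun_prop)) ?_
    rw [uIoc_of_le hs.le]
    refine (ae_restrict_iff' measurableSet_Ioc).2 (Eventually.of_forall fun r hr => ?_)
    have hr0 : 0 < r := hr.1
    beta_reduce
    rw [Real.norm_eq_abs, abs_of_nonneg (by positivity), show (-1 / 2 : ℝ) = -(1 / 2) by norm_num,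
      Real.rpow_neg hr0.le, ← Real.sqrt_eq_rpow, ← one_div]
    refine div_le_div₀ zero_le_one (Real.exp_le_one_iff.2 ?_) (Real.sqrt_pos.2 hr0)
      (Real.sqrt_le_sqrt ?_)
    · exact div_nonpos_of_nonpos_of_nonneg (by nlinarith) (by positivity)
    · nlinarith [Real.pi_gt_three]
  have h := intervalIntegral.integral_eq_sub_of_hasDerivAt_of_tendsto hs
    (fun r hr => hderiv r hr.1) hint hlim
    ((hderiv s hs).continuousAt.tendsto.mono_left nhdsWithin_le_nhds)
  rw [green, h, sub_zero]

/-- The rescaled limit profile: the Gaussian tail seen at the point `(1, a)` from a source that is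
switched on at the point `(x, a x²)` of the parabola `t = a x²`. -/
noncomputable def tailProfile (a x : ℝ) : ℝ := gaussTail √((1 - x) / (4 * a * (1 + x)))

theorem tailProfile_nonneg (a x : ℝ) : 0 ≤ tailProfile a x := gaussTail_nonneg _

theorem measurable_tailProfile (a : ℝ) : Measurable (tailProfile a) := by
  have : Continuous gaussTail :=
    continuous_iff_continuousAt.2 fun x => (hasDerivAt_gaussTail x).continuousAt
  exact this.measurable.comp (by fun_prop)

theorem tailProfile_mono {a x y : ℝ} (ha : 0 < a) (hx : -1 < x) (hxy : x ≤ y) (hy : y ≤ 1) :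
    tailProfile a x ≤ tailProfile a y := by
  apply gaussTail_antitone
  apply Real.sqrt_le_sqrt
  have h1 : 0 < 1 + x := by linarith
  have h2 : 0 < 1 + y := by linarith
  gcongr
  linarith

theorem sqrt_profile_arg {a x : ℝ} (ha : 0 < a) (hx : x ∈ Ioo (-1) 1) :
    √((1 - x) / (4 * a * (1 + x))) = (1 - x) / (2 * √(a * (1 - x ^ 2))) := by
  have h1 : 0 < 1 + x := by linarith [hx.1]
  have h2 : 0 < 1 - x := by linarith [hx.2]
  have h3 : 0 < a * (1 - x ^ 2) := by
    have : 1 - x ^ 2 = (1 - x) * (1 + x) := by ring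
    rw [this]; positivity
  rw [Real.sqrt_eq_iff_mul_self_eq (by positivity) (by positivity), ← sq, div_pow, mul_pow,
    Real.sq_sqrt h3.le, div_eq_div_iff (by positivity) (by positivity)]
  ring

theorem green_parabola {a x : ℝ} (ha : 0 < a) (hx : x ∈ Ioo (-1) 1) :
    green (1 - x) (a * (1 - x ^ 2)) =
      √(a * (1 - x ^ 2)) / √Real.pi * Real.exp (-((1 - x) / (4 * a * (1 + x)))) -
        (1 - x) * tailProfile a x := by
  have h1 : 0 < 1 + x := by linarith [hx.1]
  have h2 : 0 < 1 - x := by linarith [hx.2]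
  have h4 : 1 - x ^ 2 = (1 - x) * (1 + x) := by ring
  have h3 : 0 < a * (1 - x ^ 2) := by rw [h4]; positivity
  rw [green_eq h2 h3, tailProfile, sqrt_profile_arg ha hx, Real.sqrt_div h3.le]
  congr 3
  rw [h4, neg_div]
  congr 1
  field_simp

/-- An explicit primitive of `green (1 - x) (a (1 - x²)) + (1/2 + a) tailProfile a x`. -/
noncomputable def profilePrimitive (a x : ℝ) : ℝ :=
  (x ^ 2 / 2 + (a - 1 / 2) * x + a) * tailProfile a x +
    √(a * (1 - x ^ 2)) * x / (2 * √Real.pi) * Real.exp (-((1 - x) / (4 * a * (1 + x))))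

theorem hasDerivAt_profilePrimitive {a x : ℝ} (ha : 0 < a) (hx : x ∈ Ioo (-1) 1) :
    HasDerivAt (profilePrimitive a) (√(a * (1 - x ^ 2)) / √Real.pi *
      Real.exp (-((1 - x) / (4 * a * (1 + x)))) + (a - 1 / 2 + x) * tailProfile a x) x := by
  have h1 : 0 < 1 + x := by linarith [hx.1]
  have h2 : 0 < 1 - x := by linarith [hx.2]
  have h4 : 1 - x ^ 2 = (1 - x) * (1 + x) := by ring
  have h3 : 0 < a * (1 - x ^ 2) := by rw [h4]; positivity
  have hψ : 0 < (1 - x) / (4 * a * (1 + x)) := by positivity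
  have d1 : HasDerivAt (fun x : ℝ => (1 - x) / (4 * a * (1 + x)))
      (-1 / (2 * a * (1 + x) ^ 2)) x := by
    refine (((hasDerivAt_id x).const_sub 1).div (((hasDerivAt_id x).const_add 1).const_mul (4 * a))
      (by simp only [id]; positivity)).congr_deriv ?_
    simp only [id]; field_simp; ring
  have d2 : HasDerivAt (fun x : ℝ => √(a * (1 - x ^ 2))) (-a * x / √(a * (1 - x ^ 2))) x := by
    refine (((((hasDerivAt_id x).pow 2).const_sub 1).const_mul a).sqrt
      (by simpa using h3.ne')).congr_deriv ?_
    simp only [id, Pi.pow_apply]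
    have := (Real.sqrt_pos.2 h3).ne'
    field_simp
    norm_num
  have d3 : HasDerivAt (tailProfile a) _ x := (hasDerivAt_gaussTail _).comp x (d1.sqrt hψ.ne')
  have d4 : HasDerivAt (fun x : ℝ => x ^ 2 / 2 + (a - 1 / 2) * x + a) (x + (a - 1 / 2)) x := by
    refine (((((hasDerivAt_id x).pow 2).div_const 2).add
      ((hasDerivAt_id x).const_mul (a - 1 / 2))).add_const a).congr_deriv ?_
    simp
  have d5 := (d4.mul d3).add
    ((((d2.mul (hasDerivAt_id x)).div_const (2 * √Real.pi))).mul d1.neg.exp)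
  refine d5.congr_deriv ?_
  have hspi : √Real.pi ≠ 0 := (Real.sqrt_pos.2 Real.pi_pos).ne'
  rw [Real.sq_sqrt hψ.le, sqrt_profile_arg ha hx]
  simp only [id, Pi.mul_apply, Pi.neg_apply]
  generalize Real.exp (-((1 - x) / (4 * a * (1 + x)))) = X
  generalize tailProfile a x = Φ
  have hr := Real.sq_sqrt h3.le
  have hr0 := Real.sqrt_pos.2 h3
  generalize √(a * (1 - x ^ 2)) = r at *
  generalize √Real.pi = p at *
  field_simp
  linear_combination (X * ((x * (x + (a * 2 - 1)) + a * 2) + (1 - x) * (a * 2 * (1 + x) ^ 2 + x) -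
    a * 4 * (1 + x) ^ 2 * (1 - x))) * hr

theorem tendsto_profilePrimitive_right {a : ℝ} (ha : 0 < a) :
    Tendsto (profilePrimitive a) (𝓝[<] 1) (𝓝 a) := by
  have hc : ContinuousAt (profilePrimitive a) 1 := by
    have hg : Continuous gaussTail :=
      continuous_iff_continuousAt.2 fun x => (hasDerivAt_gaussTail x).continuousAt
    have h1 : ContinuousAt (fun x : ℝ => (1 - x) / (4 * a * (1 + x))) 1 :=
      ContinuousAt.div (by fun_prop) (by fun_prop) (by norm_num; exact ha.ne')
    have h2 : ContinuousAt (tailProfile a) 1 := hg.continuousAt.comp h1.sqrt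
    unfold profilePrimitive
    fun_prop
  have e : profilePrimitive a 1 = a := by
    simp [profilePrimitive, tailProfile, gaussTail_zero]; ring
  have := hc.tendsto.mono_left (nhdsWithin_le_nhds (s := Iio 1))
  rwa [e] at this

theorem tendsto_profilePrimitive_left {a : ℝ} (ha : 0 < a) :
    Tendsto (profilePrimitive a) (𝓝[>] (-1)) (𝓝 0) := by
  have h1 : Tendsto (fun x : ℝ => (1 - x) / (4 * a * (1 + x))) (𝓝[>] (-1)) atTop := by
    have e : ∀ x : ℝ, (1 - x) / (4 * a * (1 + x)) = (1 - x) / (4 * a) * (1 + x)⁻¹ := fun x => by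
      rw [← div_eq_mul_inv, div_div]
    simp only [e]
    refine Tendsto.pos_mul_atTop (C := 2 / (4 * a)) (by positivity) ?_ ?_
    · have : Continuous fun x : ℝ => (1 - x) / (4 * a) := by fun_prop
      have h := (this.tendsto (-1)).mono_left (nhdsWithin_le_nhds (s := Ioi (-1)))
      norm_num at h ⊢
      exact h
    · refine tendsto_inv_nhdsGT_zero.comp (tendsto_nhdsWithin_iff.2 ⟨?_, ?_⟩)
      · have : Continuous fun x : ℝ => 1 + x := by fun_prop
        simpa using (this.tendsto (-1)).mono_left (nhdsWithin_le_nhds (s := Ioi (-1)))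
      · filter_upwards [self_mem_nhdsWithin] with x (hx : -1 < x)
        exact mem_Ioi.2 (by linarith)
  have h2 : Tendsto (tailProfile a) (𝓝[>] (-1)) (𝓝 0) :=
    tendsto_gaussTail.comp (Real.tendsto_sqrt_atTop.comp h1)
  have h3 : Tendsto (fun x : ℝ => Real.exp (-((1 - x) / (4 * a * (1 + x))))) (𝓝[>] (-1)) (𝓝 0) :=
    Real.tendsto_exp_neg_atTop_nhds_zero.comp h1
  have h4 : Tendsto (fun x : ℝ => x ^ 2 / 2 + (a - 1 / 2) * x + a) (𝓝[>] (-1)) (𝓝 _) :=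
    ((by fun_prop : Continuous fun x : ℝ => x ^ 2 / 2 + (a - 1 / 2) * x + a).tendsto
      (-1)).mono_left nhdsWithin_le_nhds
  have h5 : Tendsto (fun x : ℝ => √(a * (1 - x ^ 2)) * x / (2 * √Real.pi)) (𝓝[>] (-1)) (𝓝 _) :=
    ((by fun_prop : Continuous fun x : ℝ => √(a * (1 - x ^ 2)) * x / (2 * √Real.pi)).tendsto
      (-1)).mono_left nhdsWithin_le_nhds
  have h6 := (h4.mul h2).add (h5.mul h3)
  simp only [mul_zero, add_zero] at h6
  exact h6

theorem intervalIntegrable_of_bounded {f : ℝ → ℝ} (hf : Measurable f) {C : ℝ}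
    (h : ∀ x ∈ Ioo (-1 : ℝ) 1, |f x| ≤ C) : IntervalIntegrable f volume (-1) 1 := by
  rw [intervalIntegrable_iff_integrableOn_Ioo_of_le (by norm_num)]
  exact Measure.integrableOn_of_bounded (by simp) hf.aestronglyMeasurable
    ((ae_restrict_iff' measurableSet_Ioo).2 (Eventually.of_forall h))

theorem abs_tailProfile_le (a x : ℝ) : |tailProfile a x| ≤ 1 / 2 := by
  rw [abs_of_nonneg (tailProfile_nonneg a x)]
  exact gaussTail_le_half (Real.sqrt_nonneg _)

theorem intervalIntegrable_tailProfile (a : ℝ) :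
    IntervalIntegrable (tailProfile a) volume (-1) 1 :=
  intervalIntegrable_of_bounded (measurable_tailProfile a) fun x _ => abs_tailProfile_le a x

/-- The identity that ties the value of the self-similar limit at the front, on the left, to its
slope there, which is determined by the integral of the tail profile. -/
theorem integral_green_parabola {a : ℝ} (ha : 0 < a) :
    ∫ x in (-1 : ℝ)..1, green (1 - x) (a * (1 - x ^ 2)) =
      a - (1 / 2 + a) * ∫ x in (-1 : ℝ)..1, tailProfile a x := by
  have hpi := Real.pi_pos
  have hI1 : IntervalIntegrable (fun x => √(a * (1 - x ^ 2)) / √Real.pi *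
      Real.exp (-((1 - x) / (4 * a * (1 + x)))) + (a - 1 / 2 + x) * tailProfile a x)
      volume (-1) 1 := by
    have hm := measurable_tailProfile a
    refine intervalIntegrable_of_bounded (by fun_prop) (C := √a / √Real.pi + (a + 2) * (1 / 2))
      fun x hx => ?_
    have h1 : 0 < 1 + x := by linarith [hx.1]
    have h2 : 0 < 1 - x := by linarith [hx.2]
    refine (abs_add_le _ _).trans (add_le_add ?_ ?_)
    · rw [abs_of_nonneg (by positivity)]
      refine (mul_le_of_le_one_right (by positivity)
        (Real.exp_le_one_iff.2 (neg_nonpos.2 (by positivity)))).trans ?_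
      gcongr
      nlinarith [sq_nonneg x]
    · rw [abs_mul]
      refine mul_le_mul (abs_le.2 ⟨by linarith [hx.1], by linarith [hx.2]⟩)
        (abs_tailProfile_le a x) (abs_nonneg _) (by positivity)
  have h := intervalIntegral.integral_eq_sub_of_hasDerivAt_of_tendsto (by norm_num)
    (fun x hx => hasDerivAt_profilePrimitive ha hx) hI1
    (tendsto_profilePrimitive_left ha) (tendsto_profilePrimitive_right ha)
  rw [sub_zero] at h
  have h2 : ∫ x in (-1 : ℝ)..1, green (1 - x) (a * (1 - x ^ 2)) =
      (∫ x in (-1 : ℝ)..1, (√(a * (1 - x ^ 2)) / √Real.pi *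
        Real.exp (-((1 - x) / (4 * a * (1 + x)))) + (a - 1 / 2 + x) * tailProfile a x)) -
      (1 / 2 + a) * ∫ x in (-1 : ℝ)..1, tailProfile a x := by
    rw [← intervalIntegral.integral_const_mul, ← intervalIntegral.integral_sub hI1
      ((intervalIntegrable_tailProfile a).const_mul _),
      intervalIntegral.integral_of_le (by norm_num), intervalIntegral.integral_of_le (by norm_num),
      integral_Ioc_eq_integral_Ioo, integral_Ioc_eq_integral_Ioo]
    refine setIntegral_congr_fun measurableSet_Ioo fun x hx => ?_
    simp only [green_parabola ha hx]
    ring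
  rw [h2, h]

/-- If the leading coefficient of the front value vanishes, then so does that of the slope. -/
theorem mul_integral_tailProfile_of_leadingCoeff_eq_zero {ρ a : ℝ} (ha : 0 < a)
    (h : leadingCoeff ρ a = 0) : ρ * ∫ x in (-1 : ℝ)..1, tailProfile a x = 2 := by
  rw [leadingCoeff, integral_green_parabola ha] at h
  have h1 : (1 + 2 * a) * (ρ * (∫ x in (-1 : ℝ)..1, tailProfile a x) - 2) = 0 := by
    linear_combination 2 * h
  have h2 : 1 + 2 * a ≠ 0 := by positivity
  linarith [(mul_eq_zero.1 h1).resolve_left h2]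

/-! ### The explicit solution for prescribed moments -/

/-- The explicit solution for prescribed switching moments: the solution of the problem in which
no node ever switches, minus the responses of the lattice to the switched-off sources. Moments
before time `0` act as moments at time `0`. -/
noncomputable def model (h₁ c : ℝ) (t : ℕ → ℝ) (n : ℕ) (k : ℤ) (s : ℝ) : ℝ :=
  -c * (k : ℝ) ^ 2 + (h₁ - 2 * c) * s -
    h₁ * ∑ i ∈ Finset.Ioo (-(n : ℤ)) n, latticeGreen (k - i) (s - max (t i.natAbs) 0)

theorem prescribedOutput_eq (h₁ : ℝ) (t : ℕ → ℝ) (n : ℕ) (k : ℤ) {s : ℝ} (hs : 0 ≤ s) :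
    prescribedOutput h₁ t n k s = h₁ - h₁ * ∑ i ∈ Finset.Ioo (-(n : ℤ)) n,
      if k - i = 0 ∧ 0 ≤ s - max (t i.natAbs) 0 then 1 else 0 := by
  have e : ∀ i : ℤ, (k - i = 0 ∧ 0 ≤ s - max (t i.natAbs) 0) ↔ k = i ∧ t k.natAbs ≤ s := by
    intro i
    rw [sub_eq_zero, sub_nonneg, max_le_iff]
    constructor
    · rintro ⟨rfl, h, _⟩; exact ⟨rfl, h⟩
    · rintro ⟨rfl, h⟩; exact ⟨rfl, h, hs⟩
  simp only [e, ite_and, Finset.sum_ite_eq, Finset.mem_Ioo]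
  unfold prescribedOutput
  by_cases h1 : k.natAbs < n
  · have h2 : -(n : ℤ) < k ∧ k < n := by omega
    by_cases h3 : t k.natAbs ≤ s <;> simp [h1, h2, h3]
  · have h2 : ¬ (-(n : ℤ) < k ∧ k < n) := by omega
    have h3 : ∀ x : ℝ, (if -(n : ℤ) < k then if k < n then x else 0 else 0) = 0 := fun x => by
      rw [← ite_and, if_neg h2]
    simp [h1, h3]

theorem isLatticeSolution_model (h₁ c : ℝ) (t : ℕ → ℝ) (n : ℕ) :
    IsLatticeSolution (prescribedOutput h₁ t n) 0 (model h₁ c t n) where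
  continuousOn k := by
    have := continuous_latticeGreen
    unfold model
    apply Continuous.continuousOn
    fun_prop
  growth T := by
    obtain ⟨A, α, h⟩ := exists_exp_bound_sq |c| (|h₁ - 2 * c| * |T| +
      |h₁| * ∑ i ∈ Finset.Ioo (-(n : ℤ)) n, |T|)
    refine ⟨A, α, fun k s hs => h k _ ?_⟩
    have hsT : s ≤ |T| := hs.2.trans (le_abs_self T)
    rw [model]
    refine (abs_sub _ _).trans ?_
    rw [← add_assoc]
    refine add_le_add ((abs_add_le _ _).trans (add_le_add ?_ ?_)) ?_
    · rw [abs_mul, abs_neg, abs_sq]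
    · rw [abs_mul, abs_of_nonneg hs.1]; gcongr
    · rw [abs_mul]
      refine mul_le_mul_of_nonneg_left ((Finset.abs_sum_le_sum_abs _ _).trans
        (Finset.sum_le_sum fun i _ => ?_)) (abs_nonneg _)
      rw [abs_of_nonneg (latticeGreen_nonneg _ _)]
      refine (latticeGreen_le _ _).trans (max_le ?_ (abs_nonneg T))
      linarith [le_max_right (t i.natAbs) 0]
  deriv k s hs := by
    have h1 : ∀ i ∈ Finset.Ioo (-(n : ℤ)) n,
        HasDerivWithinAt (fun s => latticeGreen (k - i) (s - max (t i.natAbs) 0))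
          (lap latticeGreen (k - i) (s - max (t i.natAbs) 0) +
            if k - i = 0 ∧ 0 ≤ s - max (t i.natAbs) 0 then 1 else 0) (Ici s) s := by
      intro i _
      have hsub : HasDerivWithinAt (fun s : ℝ => s - max (t i.natAbs) 0) 1 (Ici s) s :=
        ((hasDerivAt_id s).sub_const _).hasDerivWithinAt
      have := (hasDerivWithinAt_latticeGreen (k - i) (s - max (t i.natAbs) 0)).comp s hsub
        (fun r (hr : s ≤ r) => by simpa using hr)
      exact this.congr_deriv (mul_one _)
    have h2 : HasDerivAt (fun s : ℝ => -c * (k : ℝ) ^ 2 + (h₁ - 2 * c) * s) ((h₁ - 2 * c) * 1) s :=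
      ((hasDerivAt_id s).const_mul _).const_add _
    have h3 := h2.hasDerivWithinAt.sub ((HasDerivWithinAt.fun_sum h1).const_mul h₁)
    refine h3.congr_deriv ?_
    rw [prescribedOutput_eq h₁ t n k hs, Finset.sum_add_distrib]
    simp only [lap, model]
    simp only [Finset.sum_add_distrib, Finset.sum_sub_distrib, ← Finset.mul_sum,
      add_sub_right_comm k 1, sub_right_comm k 1]
    push_cast
    ring

theorem model_zero (h₁ c : ℝ) (t : ℕ → ℝ) (n : ℕ) (k : ℤ) :
    model h₁ c t n k 0 = -c * (k : ℝ) ^ 2 := by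
  simp [model, latticeGreen_of_nonpos]

theorem grad_model (h₁ c : ℝ) (t : ℕ → ℝ) (n : ℕ) (j : ℤ) (s : ℝ) :
    grad (model h₁ c t n) j s = -c * (2 * j + 1) +
      h₁ * ∑ i ∈ Finset.Ioo (-(n : ℤ)) n, latticeTail (j - i) (s - max (t i.natAbs) 0) := by
  simp only [grad, model, latticeTail, Finset.sum_sub_distrib, add_sub_right_comm j 1]
  push_cast
  ring

/-- Ahead of the front the slope increases in time, so it suffices to control it at the end of the
time interval. -/
theorem grad_model_mono {h₁ c : ℝ} (hh : 0 ≤ h₁) (t : ℕ → ℝ) (n : ℕ) {j : ℤ} (hj : n ≤ j) :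
    Monotone (grad (model h₁ c t n) j) := by
  intro r s hrs
  simp only [grad_model]
  gcongr with i hi
  exact latticeTail_mono (by rw [Finset.mem_Ioo] at hi; omega) (by linarith)

/-- Ahead of the front the slope decreases in space, so it suffices to control it at the front. -/
theorem grad_model_anti {h₁ c : ℝ} (hh : 0 ≤ h₁) (hc : 0 ≤ c) (t : ℕ → ℝ) (n : ℕ) {j : ℤ}
    (hj : n ≤ j) (s : ℝ) : grad (model h₁ c t n) j s ≤ grad (model h₁ c t n) n s := by
  simp only [grad_model]
  refine add_le_add ?_ (mul_le_mul_of_nonneg_left (Finset.sum_le_sum fun i hi => ?_) hh)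
  · have : ((n : ℤ) : ℝ) ≤ (j : ℝ) := by exact_mod_cast hj
    nlinarith
  · rw [Finset.mem_Ioo] at hi
    exact latticeTail_anti (by omega) (by omega) _

/-! ### The slope at the front -/

/-- A sum over `|i| < n` of terms that depend on `|i|` only. -/
theorem sum_natAbs_le (n : ℕ) {f : ℕ → ℝ} (hf : ∀ k < n, 0 ≤ f k) :
    ∑ i ∈ Finset.Ioo (-(n : ℤ)) n, f i.natAbs ≤ 2 * ∑ k ∈ Finset.range n, f k := by
  rw [← Finset.sum_fiberwise_of_maps_to (s := Finset.Ioo (-(n : ℤ)) n) (t := Finset.range n)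
    (g := Int.natAbs) (fun i hi => by rw [Finset.mem_Ioo] at hi; rw [Finset.mem_range]; omega),
    Finset.mul_sum]
  refine Finset.sum_le_sum fun k hk => ?_
  have h1 : ∑ i ∈ Finset.Ioo (-(n : ℤ)) n with i.natAbs = k, f i.natAbs =
      ∑ i ∈ Finset.Ioo (-(n : ℤ)) n with i.natAbs = k, f k :=
    Finset.sum_congr rfl fun i hi => by rw [(Finset.mem_filter.1 hi).2]
  rw [h1, Finset.sum_const, nsmul_eq_mul]
  refine mul_le_mul_of_nonneg_right ?_ (hf k (Finset.mem_range.1 hk))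
  have h2 : (Finset.Ioo (-(n : ℤ)) n).filter (fun i => i.natAbs = k) ⊆ {(k : ℤ), -(k : ℤ)} := by
    intro i hi
    have := (Finset.mem_filter.1 hi).2
    simp only [Finset.mem_insert, Finset.mem_singleton]
    omega
  exact_mod_cast (Finset.card_le_card h2).trans Finset.card_le_two

theorem sum_range_one_div_sub_le (n : ℕ) :
    ∑ k ∈ Finset.range n, 1 / ((n : ℝ) - k) ≤ 1 + Real.log n := by
  have h := harmonic_le_one_add_log n
  rw [harmonic] at h
  rw [← Finset.sum_range_reflect]
  refine le_trans (le_of_eq ?_) h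
  push_cast
  refine Finset.sum_congr rfl fun k hk => ?_
  have : ((n - 1 - k : ℕ) : ℝ) = (n : ℝ) - 1 - k := by
    have := Finset.mem_range.1 hk
    rw [Nat.cast_sub (by omega), Nat.cast_sub (by omega)]; simp
  rw [this, one_div]
  congr 1; ring

/-- The tail profile is increasing, so its left Riemann sum is at most the integral. -/
theorem sum_tailProfile_le {a : ℝ} (ha : 0 < a) {n : ℕ} (hn : 0 < n) :
    ∑ i ∈ Finset.Ioo (-(n : ℤ)) n, tailProfile a ((i : ℝ) / n) ≤
      n * ∫ x in (-1 : ℝ)..1, tailProfile a x := by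
  have hn0 : (0 : ℝ) < n := by exact_mod_cast hn
  have hmono : MonotoneOn (fun x : ℝ => tailProfile a (x / n))
      (Icc (-((n : ℝ) - 1)) (-((n : ℝ) - 1) + (2 * n - 1 : ℕ))) := by
    have e : ((2 * n - 1 : ℕ) : ℝ) = 2 * n - 1 := by
      rw [Nat.cast_sub (by omega)]; simp
    rw [e]
    intro x hx y hy hxy
    refine tailProfile_mono ha ?_ (by gcongr) ?_
    · rw [lt_div_iff₀ hn0]; linarith [hx.1]
    · rw [div_le_one hn0]; linarith [hy.2]
  have h := hmono.sum_le_integral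
  have e1 : ∑ i ∈ Finset.Ioo (-(n : ℤ)) n, tailProfile a ((i : ℝ) / n) =
      ∑ i ∈ Finset.range (2 * n - 1), tailProfile a ((-((n : ℝ) - 1) + i) / n) := by
    refine Finset.sum_nbij' (fun i => (i + (n - 1)).toNat) (fun j => (j : ℤ) - (n - 1))
      ?_ ?_ ?_ ?_ ?_
    · intro i hi; rw [Finset.mem_Ioo] at hi; rw [Finset.mem_range]; omega
    · intro j hj; rw [Finset.mem_range] at hj; rw [Finset.mem_Ioo]; omega
    · intro i hi; rw [Finset.mem_Ioo] at hi; omega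
    · intro j hj; omega
    · intro i hi
      rw [Finset.mem_Ioo] at hi
      have : (((i + (n - 1)).toNat : ℕ) : ℝ) = (i : ℝ) + (n - 1) := by
        have h1 : (((i + (n - 1)).toNat : ℕ) : ℤ) = i + (n - 1) := Int.toNat_of_nonneg (by omega)
        exact_mod_cast congrArg (Int.cast : ℤ → ℝ) h1
      rw [this]; congr 2; ring
  have e2 : -((n : ℝ) - 1) + ((2 * n - 1 : ℕ) : ℝ) = n := by
    rw [Nat.cast_sub (by omega)]; push_cast; ring
  rw [e1]
  refine h.trans ?_
  rw [e2, intervalIntegral.integral_comp_div (fun x => tailProfile a x) hn0.ne', smul_eq_mul,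
    div_self hn0.ne']
  refine mul_le_mul_of_nonneg_left ?_ hn0.le
  refine intervalIntegral.integral_mono_interval ?_ ?_ le_rfl ?_ (intervalIntegrable_tailProfile a)
  · rw [le_div_iff₀ hn0]; linarith
  · rw [div_le_one hn0]
    have : (1 : ℝ) ≤ n := by exact_mod_cast hn
    linarith
  · exact Eventually.of_forall fun x => tailProfile_nonneg a x

/-- Switching moments within distance `E √k` of `a k²`, for the nodes `k ≤ n`. -/
def NearParabola (a E : ℝ) (t : ℕ → ℝ) (n : ℕ) : Prop :=
  ∀ k ≤ n, |t k - a * (k : ℝ) ^ 2| ≤ E * √k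

theorem NearParabola.mono {a E : ℝ} {t : ℕ → ℝ} {m n : ℕ} (h : NearParabola a E t n) (hmn : m ≤ n) :
    NearParabola a E t m := fun k hk => h k (hk.trans hmn)

/-- Cutting off negative moments at time `0` does not increase their distance from the parabola. -/
theorem NearParabola.abs_max_sub_le {a E : ℝ} (ha : 0 ≤ a) (hE : 0 ≤ E) {t : ℕ → ℝ} {n : ℕ}
    (h : NearParabola a E t n) {k : ℕ} (hk : k ≤ n) :
    |max (t k) 0 - a * (k : ℝ) ^ 2| ≤ E * √n := by
  have h1 : |max (t k) 0 - max (a * (k : ℝ) ^ 2) 0| ≤ |t k - a * (k : ℝ) ^ 2| :=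
    abs_max_sub_max_le_abs _ _ _
  rw [max_eq_left (a := a * (k : ℝ) ^ 2) (by positivity)] at h1
  refine h1.trans ((h k hk).trans ?_)
  have : (k : ℝ) ≤ n := by exact_mod_cast hk
  gcongr

theorem sq_sub_sq_natAbs (n : ℕ) (i : ℤ) :
    (n : ℝ) ^ 2 - (i.natAbs : ℝ) ^ 2 = ((n : ℝ) - i) * (n + i) := by
  rw [Nat.cast_natAbs, Int.cast_abs, sq_abs]; ring

/-- A single term of the slope at the front: it exceeds its value on the exact parabola, in the
continuum limit, by at most `O(√n / (n (n - |i|)))`. -/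
theorem latticeTail_le_profile {a E C : ℝ} (ha : 0 < a) (hE : 0 ≤ E) (hC : 0 ≤ C)
    (hT : ∀ m : ℕ, ∀ s, 0 < s → latticeTail m s ≤ gaussTail (m / (2 * √s)) + C / s)
    {t : ℕ → ℝ} {n : ℕ} (ht : NearParabola a E t n) {i : ℤ} (hi : i ∈ Finset.Ioo (-(n : ℤ)) n) :
    latticeTail (n - i) (t n - max (t i.natAbs) 0) ≤
      tailProfile a ((i : ℝ) / n) + (2 * E * √n + C) / (a * n) * (1 / ((n : ℝ) - i.natAbs)) := by
  rw [Finset.mem_Ioo] at hi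
  have hn : (0 : ℝ) < n := by
    have : 0 < n := by omega
    exact_mod_cast this
  have hl : (0 : ℝ) < (n : ℝ) - i.natAbs := by
    have : i.natAbs < n := by omega
    have : (i.natAbs : ℝ) < n := by exact_mod_cast this
    linarith
  have hni : (0 : ℝ) < (n : ℝ) - i := by
    have : (i : ℝ) < n := by exact_mod_cast hi.2
    linarith
  have hni' : (0 : ℝ) < (n : ℝ) + i := by
    have : -(n : ℝ) < i := by exact_mod_cast hi.1
    linarith
  set l : ℝ := (n : ℝ) - i.natAbs with hldef
  -- `s₀` is the elapsed time on the exact parabola, `s₀ (1 + ε)` bounds the true elapsed time.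
  set s₀ : ℝ := a * ((n : ℝ) ^ 2 - (i.natAbs : ℝ) ^ 2) with hs0
  set ε : ℝ := 2 * E * √n / (a * n * l) with hε
  have hε0 : 0 ≤ ε := by positivity
  have hs0ge : a * n * l ≤ s₀ := by
    have : s₀ = a * ((n + i.natAbs) * l) := by rw [hs0, hldef]; ring
    rw [this, mul_assoc]
    have : (0 : ℝ) ≤ i.natAbs := Nat.cast_nonneg _
    gcongr
    linarith
  have hs0pos : 0 < s₀ := lt_of_lt_of_le (by positivity) hs0ge
  have hsle : t n - max (t i.natAbs) 0 ≤ s₀ * (1 + ε) := by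
    have h1 := (abs_le.1 (ht n le_rfl)).2
    have h2 := (abs_le.1 (ht.abs_max_sub_le ha.le hE (k := i.natAbs) (by omega))).1
    have h3 : 2 * E * √n ≤ s₀ * ε := by
      calc 2 * E * √n = a * n * l * ε := by rw [hε]; field_simp
        _ ≤ s₀ * ε := by gcongr
    rw [mul_add, mul_one, hs0] at *
    linarith
  have hm : ((n : ℤ) - i) = (((n : ℤ) - i).toNat : ℤ) := (Int.toNat_of_nonneg (by omega)).symm
  have hm' : ((((n : ℤ) - i).toNat : ℕ) : ℝ) = (n : ℝ) - i := by
    exact_mod_cast congrArg (Int.cast : ℤ → ℝ) hm.symm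
  have hspos : 0 < s₀ * (1 + ε) := by positivity
  have h1 : latticeTail (n - i) (t n - max (t i.natAbs) 0) ≤
      gaussTail (((n : ℝ) - i) / (2 * √(s₀ * (1 + ε)))) + C / (s₀ * (1 + ε)) := by
    refine (latticeTail_mono (by omega) hsle).trans ?_
    have := hT ((n : ℤ) - i).toNat (s₀ * (1 + ε)) hspos
    rwa [hm', ← hm] at this
  have hsq : √(1 + ε) ≤ 1 + ε := by
    rw [Real.sqrt_le_left (by positivity)]
    nlinarith
  have hsq1 : 1 ≤ √(1 + ε) := Real.one_le_sqrt.2 (by linarith)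
  have h2 : gaussTail (((n : ℝ) - i) / (2 * √(s₀ * (1 + ε)))) ≤
      gaussTail (((n : ℝ) - i) / (2 * √s₀)) + ε := by
    have hr := Real.sqrt_pos.2 hs0pos
    rw [Real.sqrt_mul hs0pos.le]
    refine gaussTail_le_add hε0 (by positivity) ?_ ?_
    · gcongr
      nlinarith
    · have : ((n : ℝ) - i) / (2 * √s₀) =
          ((n : ℝ) - i) / (2 * (√s₀ * √(1 + ε))) * √(1 + ε) := by field_simp
      rw [this]
      gcongr
  have h3 : ((n : ℝ) - i) / (2 * √s₀) = √((1 - (i : ℝ) / n) / (4 * a * (1 + (i : ℝ) / n))) := by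
    have e1 : (0 : ℝ) < 1 + (i : ℝ) / n := by
      rw [show 1 + (i : ℝ) / n = ((n : ℝ) + i) / n by field_simp]; positivity
    have e2 : (0 : ℝ) < 1 - (i : ℝ) / n := by
      rw [show 1 - (i : ℝ) / n = ((n : ℝ) - i) / n by field_simp]; positivity
    rw [eq_comm, Real.sqrt_eq_iff_mul_self_eq (by positivity) (by positivity), ← sq, div_pow,
      mul_pow, Real.sq_sqrt hs0pos.le, hs0, sq_sub_sq_natAbs]
    field_simp
    ring
  have h4 : C / (s₀ * (1 + ε)) ≤ C / (a * n * l) := by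
    refine div_le_div_of_nonneg_left hC (by positivity) ?_
    nlinarith
  rw [h3] at h2
  have h5 : (2 * E * √n + C) / (a * n) * (1 / l) = ε + C / (a * n * l) := by
    rw [hε]; field_simp
  rw [h5, tailProfile]
  linarith

/-- The slope at the front is negative, uniformly over all admissible sequences of moments: the
leading terms `-2 c n` and `h₁ n ∫ tailProfile` cancel by the root condition, the errors tend to
zero, and `-c` is left over. -/
theorem eventually_grad_model_le {h₁ c a E : ℝ} (hc : 0 < c) (hh : 0 < h₁) (ha : 0 < a)
    (hroot : leadingCoeff (h₁ / c) a = 0) (hE : 0 ≤ E) :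
    ∀ᶠ n : ℕ in atTop, ∀ t, NearParabola a E t n → grad (model h₁ c t n) n (t n) ≤ -(c / 2) := by
  obtain ⟨C, hC, hT⟩ := exists_latticeTail_le
  have hJ : h₁ * ∫ x in (-1 : ℝ)..1, tailProfile a x = 2 * c := by
    have := mul_integral_tailProfile_of_leadingCoeff_eq_zero ha hroot
    field_simp at this
    linarith
  have hlim : Tendsto (fun n : ℕ => h₁ * ((2 * E * √n + C) / (a * n) * (2 * (1 + Real.log n))))
      atTop (𝓝 0) := by
    have t1 : Tendsto (fun n : ℕ => (√(n : ℝ))⁻¹) atTop (𝓝 0) :=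
      (Real.tendsto_sqrt_atTop.comp tendsto_natCast_atTop_atTop).inv_tendsto_atTop
    have t2 : Tendsto (fun n : ℕ => Real.log n / √(n : ℝ)) atTop (𝓝 0) := by
      have := (isLittleO_log_rpow_atTop (by norm_num : (0 : ℝ) < 1 / 2)).tendsto_div_nhds_zero
      simpa only [← Real.sqrt_eq_rpow, Function.comp_def] using
        this.comp tendsto_natCast_atTop_atTop
    have t3 := (((t1.const_mul C).const_add (2 * E)).mul ((t1.add t2).const_mul 2)).const_mul
      (h₁ / a)
    simp only [add_zero, mul_zero] at t3
    refine t3.congr' ?_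
    filter_upwards [eventually_gt_atTop 0] with n hn
    have hn0 : (0 : ℝ) < n := by exact_mod_cast hn
    have hr := Real.sqrt_pos.2 hn0
    have e : (n : ℝ) = √(n : ℝ) ^ 2 := (Real.sq_sqrt hn0.le).symm
    generalize Real.log (n : ℝ) = L
    rw [show a * (n : ℝ) = a * √(n : ℝ) ^ 2 by rw [← e]]
    generalize √(n : ℝ) = r at *
    field_simp
  filter_upwards [hlim.eventually_le_const (by positivity : 0 < c / 2), eventually_gt_atTop 0]
    with n hn hn0 t ht
  have h1 : ∑ i ∈ Finset.Ioo (-(n : ℤ)) n, latticeTail (n - i) (t n - max (t i.natAbs) 0) ≤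
      n * (∫ x in (-1 : ℝ)..1, tailProfile a x) +
        (2 * E * √n + C) / (a * n) * (2 * (1 + Real.log n)) := by
    refine (Finset.sum_le_sum fun i hi => latticeTail_le_profile ha hE hC.le hT ht hi).trans ?_
    rw [Finset.sum_add_distrib, ← Finset.mul_sum]
    refine add_le_add (sum_tailProfile_le ha hn0) (mul_le_mul_of_nonneg_left ?_ (by positivity))
    refine (sum_natAbs_le n (f := fun k => 1 / ((n : ℝ) - k)) fun k hk => ?_).trans
      (mul_le_mul_of_nonneg_left (sum_range_one_div_sub_le n) zero_le_two)
    have : (k : ℝ) ≤ n := by exact_mod_cast hk.le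
    exact one_div_nonneg.2 (by linarith)
  have h2 := mul_le_mul_of_nonneg_left h1 hh.le
  rw [grad_model]
  push_cast
  have h3 : h₁ * (n * (∫ x in (-1 : ℝ)..1, tailProfile a x)) = n * (2 * c) := by rw [← hJ]; ring
  rw [mul_add, h3] at h2
  linarith

/-! ### Chords of the Green function -/

theorem heatKer_zero_antitoneOn : AntitoneOn (heatKer 0) (Ici 0) := by
  refine antitoneOn_of_deriv_nonpos (convex_Ici 0) (continuous_heatKer 0).continuousOn
    (fun s _ => (hasDerivAt_heatKer 0 s).differentiableAt.differentiableWithinAt) fun s hs => ?_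
  rw [interior_Ici] at hs
  rw [(hasDerivAt_heatKer 0 s).deriv, lap, zero_sub, zero_add, heatKer_neg]
  have := heatKer_succ_le le_rfl (le_of_lt hs)
  rw [zero_add] at this
  linarith

theorem latticeGreen_eq_integral (m : ℤ) {s : ℝ} (hs : 0 ≤ s) :
    latticeGreen m s = ∫ r in (0 : ℝ)..s, heatKer m r := by
  rw [latticeGreen, max_eq_left hs]

theorem latticeGreen_zero_concaveOn : ConcaveOn ℝ (Ici 0) (latticeGreen 0) := by
  refine AntitoneOn.concaveOn_of_deriv (convex_Ici 0) (continuous_latticeGreen 0).continuousOn ?_ ?_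
  · intro s hs
    rw [interior_Ici] at hs
    exact (hasDerivAt_latticeGreen 0 hs).differentiableAt.differentiableWithinAt
  · intro r hr s hs hrs
    rw [interior_Ici] at hr hs
    rw [(hasDerivAt_latticeGreen 0 hr).deriv, (hasDerivAt_latticeGreen 0 hs).deriv]
    exact heatKer_zero_antitoneOn (mem_Ici.2 (le_of_lt hr)) (mem_Ici.2 (le_of_lt hs)) hrs

theorem exists_le_latticeGreen_zero : ∃ b, 0 < b ∧ ∀ s, 1 ≤ s → b * √s ≤ latticeGreen 0 s := by
  obtain ⟨b, hb, h⟩ := exists_le_heatKer_zero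
  refine ⟨b, hb, fun s hs => ?_⟩
  have hs0 : 0 < s := by linarith
  have h1 : ∫ r in (0 : ℝ)..s, heatKer 0 s ≤ ∫ r in (0 : ℝ)..s, heatKer 0 r :=
    intervalIntegral.integral_mono_on hs0.le intervalIntegrable_const
      (intervalIntegrable_heatKer _ _ _)
      fun r hr => heatKer_zero_antitoneOn hr.1 hs0.le hr.2
  rw [intervalIntegral.integral_const, sub_zero, smul_eq_mul] at h1
  rw [latticeGreen_eq_integral 0 hs0.le]
  refine le_trans ?_ h1
  have h2 := mul_le_mul_of_nonneg_left (h s hs) hs0.le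
  refine le_trans (le_of_eq ?_) h2
  rw [show (-1 / 2 : ℝ) = 1 / 2 - 1 by norm_num, Real.rpow_sub_one hs0.ne', ← Real.sqrt_eq_rpow]
  field_simp

theorem exists_latticeGreen_zero_le :
    ∃ C, 0 < C ∧ ∀ s, 0 < s → latticeGreen 0 s ≤ C * √s := by
  obtain ⟨C, hC, h⟩ := exists_heatKer_le
  refine ⟨2 * C, by positivity, fun s hs => ?_⟩
  have hi : IntervalIntegrable (fun r : ℝ => C * r ^ (-1 / 2 : ℝ)) volume 0 s :=
    (intervalIntegral.intervalIntegrable_rpow' (by norm_num)).const_mul C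
  have h1 : ∫ r in (0 : ℝ)..s, heatKer 0 r ≤ ∫ r in (0 : ℝ)..s, C * r ^ (-1 / 2 : ℝ) :=
    intervalIntegral.integral_mono_on_of_le_Ioo hs.le (intervalIntegrable_heatKer _ _ _) hi
      fun r hr => h 0 r hr.1
  rw [intervalIntegral.integral_const_mul, integral_rpow (Or.inl (by norm_num))] at h1
  rw [latticeGreen_eq_integral 0 hs.le]
  refine h1.trans (le_of_eq ?_)
  norm_num [Real.sqrt_eq_rpow]
  ring

/-- The response to a source at the neighbouring node is almost above its chords over long time
intervals: it is the concave function `latticeGreen 0`, which grows like `√s`, minus a bounded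
increasing one. -/
theorem exists_chord_le_latticeGreen_one {ε : ℝ} (hε : 0 < ε) : ∃ D, 0 < D ∧ ∀ Δ, D ≤ Δ →
    ∀ s ∈ Icc 0 Δ, s / Δ * latticeGreen 1 Δ - latticeGreen 1 s ≤ ε := by
  obtain ⟨b, hb, hlow⟩ := exists_le_latticeGreen_zero
  obtain ⟨C, hC, hup⟩ := exists_latticeGreen_zero_le
  -- `r` is so large that `latticeGreen 0 r ≥ 2`, and `D` is so large that the chord of
  -- `latticeGreen 0` over `[0, Δ]` is at most `min ε 1` at `r`.
  set r : ℝ := max 1 ((2 / b) ^ 2) with hr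
  have hr1 : 1 ≤ r := le_max_left _ _
  have hr2 : 2 ≤ latticeGreen 0 r := by
    refine le_trans ?_ (hlow r hr1)
    have : 2 / b ≤ √r := Real.le_sqrt_of_sq_le (le_max_right _ _)
    rw [div_le_iff₀' hb] at this
    exact this
  set δ : ℝ := min ε 1 with hδ
  have hδ0 : 0 < δ := lt_min hε one_pos
  have hr0 : 0 < r := by linarith
  refine ⟨max (r + 1) ((r * C / δ) ^ 2), by positivity, fun Δ hΔ s hs => ?_⟩
  have hrΔ : r < Δ := by have := (le_max_left _ _).trans hΔ; linarith
  have hΔ0 : 0 < Δ := by linarith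
  have hsq : r * C / δ ≤ √Δ := Real.le_sqrt_of_sq_le ((le_max_right _ _).trans hΔ)
  have hslope : r / Δ * latticeGreen 0 Δ ≤ δ := by
    have hpos := Real.sqrt_pos.2 hΔ0
    rw [div_le_iff₀ hδ0] at hsq
    calc r / Δ * latticeGreen 0 Δ ≤ r / Δ * (C * √Δ) := by gcongr; exact hup Δ hΔ0
      _ = r * C * √Δ / √Δ ^ 2 := by rw [Real.sq_sqrt hΔ0.le]; ring
      _ = r * C / √Δ := by field_simp
      _ ≤ δ := by rw [div_le_iff₀ hpos]; linarith
  have hdec : ∀ x, latticeGreen 1 x = latticeGreen 0 x - latticeTail 0 x := fun x => by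
    simp [latticeTail]
  have hgreen0 := latticeGreen_nonneg 0 Δ
  rcases le_or_gt s r with hsr | hsr
  · have h1 : latticeGreen 1 Δ ≤ latticeGreen 0 Δ := by
      rw [hdec]; linarith [latticeTail_nonneg le_rfl Δ]
    have h2 : s / Δ * latticeGreen 1 Δ ≤ r / Δ * latticeGreen 0 Δ :=
      mul_le_mul (by gcongr) h1 (latticeGreen_nonneg _ _) (by positivity)
    linarith [latticeGreen_nonneg 1 s, min_le_left ε 1]
  · set α : ℝ := (Δ - s) / (Δ - r) with hα
    set β : ℝ := (s - r) / (Δ - r) with hβ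
    have hΔr : 0 < Δ - r := by linarith
    have hα0 : 0 ≤ α := div_nonneg (by linarith [hs.2]) hΔr.le
    have hβ0 : 0 ≤ β := div_nonneg (by linarith) hΔr.le
    have hαβ : α + β = 1 := by rw [hα, hβ]; field_simp; ring
    have hconv := latticeGreen_zero_concaveOn.2 (mem_Ici.2 hr0.le) (mem_Ici.2 hΔ0.le) hα0 hβ0 hαβ
    have hpt : α • r + β • Δ = s := by
      simp only [smul_eq_mul, hα, hβ]; field_simp; ring
    rw [hpt] at hconv
    simp only [smul_eq_mul] at hconv
    have hβs : β = s / Δ - α * (r / Δ) := by rw [hα, hβ]; field_simp; ring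
    have hαge : 1 - s / Δ ≤ α := by
      have : 1 - s / Δ = (Δ - s) / Δ := by field_simp
      rw [this, hα]
      exact div_le_div_of_nonneg_left (by linarith [hs.2]) hΔr (by linarith)
    have h1 : 1 - s / Δ ≤ latticeGreen 0 s - s / Δ * latticeGreen 0 Δ := by
      have h2 : α * 1 ≤ α * (latticeGreen 0 r - r / Δ * latticeGreen 0 Δ) :=
        mul_le_mul_of_nonneg_left (by linarith [min_le_right ε 1]) hα0
      rw [hβs] at hconv
      linarith
    have hq1 : latticeTail 0 s ≤ latticeTail 0 Δ := latticeTail_mono le_rfl hs.2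
    have hq2 : latticeTail 0 Δ ≤ 1 := by
      rw [latticeTail_zero hΔ0.le]; linarith [heatKer_nonneg 0 hΔ0.le]
    have hsΔ : 0 ≤ 1 - s / Δ := by rw [sub_nonneg, div_le_one hΔ0]; exact hs.2
    rw [hdec, hdec]
    have h3 := mul_le_mul_of_nonneg_right hq2 hsΔ
    linarith

/-! ### Gaps between the moments -/

/-- Elementary consequences of being close to the parabola `t = a k²`, for large `n`: the moments
`t k`, cut off at `0`, do not exceed `t (n - 1)`, and the gaps between them are comparable to those
on the parabola. -/
structure MomentBounds (a : ℝ) (t : ℕ → ℝ) (n : ℕ) : Prop where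
  pos : 0 < t (n - 1)
  max_le : ∀ k < n, max (t k) 0 ≤ t (n - 1)
  gap : a * n ≤ t n - t (n - 1)
  lower : ∀ k, k + 2 ≤ n → a / 8 * n * ((n : ℝ) - k) ≤ t (n - 1) - max (t k) 0
  upper : ∀ k < n, t n - max (t k) 0 ≤ 3 * a * n * ((n : ℝ) - k)

theorem NearParabola.momentBounds {a E : ℝ} (ha : 0 < a) (hE : 0 ≤ E) {t : ℕ → ℝ} {n : ℕ}
    (hn : 2 ≤ n) (hlarge : 16 * (E * √n) ≤ a * n) (ht : NearParabola a E t n) :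
    MomentBounds a t n := by
  have hn' : (2 : ℝ) ≤ n := by exact_mod_cast hn
  have hcast : ((n - 1 : ℕ) : ℝ) = n - 1 := by rw [Nat.cast_sub (by omega)]; simp
  have h0 : ∀ k ≤ n, |max (t k) 0 - a * (k : ℝ) ^ 2| ≤ E * √n := fun k hk =>
    ht.abs_max_sub_le ha.le hE hk
  have hp : a * ((n : ℝ) - 1) ^ 2 - E * √n ≤ t (n - 1) := by
    have h1 := (abs_le.1 (ht (n - 1) (by omega))).1
    have h2 : E * √((n - 1 : ℕ) : ℝ) ≤ E * √n := by gcongr; omega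
    rw [hcast] at h1 h2
    linarith
  have hp' : t (n - 1) ≤ a * ((n : ℝ) - 1) ^ 2 + E * √n := by
    have h1 := (abs_le.1 (h0 (n - 1) (by omega))).2
    rw [hcast] at h1
    linarith [le_max_left (t (n - 1)) 0]
  have hnn := abs_le.1 (ht n le_rfl)
  have hpos : 0 < t (n - 1) := by
    have : a * n ≤ a * (4 * ((n : ℝ) - 1) ^ 2) := by gcongr; nlinarith
    have : 0 < a * n := by positivity
    linarith
  have hlow : ∀ k, k + 2 ≤ n → a / 8 * n * ((n : ℝ) - k) ≤ t (n - 1) - max (t k) 0 := by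
    intro k hk
    have h1 := (abs_le.1 (h0 k (by omega))).2
    have hk' : (k : ℝ) + 2 ≤ n := by exact_mod_cast hk
    have hk0 : (0 : ℝ) ≤ k := Nat.cast_nonneg k
    have h2 : a * (n * ((n : ℝ) - k)) ≤ a * (4 * (((n : ℝ) - 1) ^ 2 - (k : ℝ) ^ 2)) := by
      refine mul_le_mul_of_nonneg_left ?_ ha.le
      have e1 : 0 ≤ ((n : ℝ) - k - 2) * ((n : ℝ) - 1 + k) :=
        mul_nonneg (by linarith) (by linarith)
      have e2 : 0 ≤ ((n : ℝ) - k) * ((n : ℝ) - 2 + 2 * k) :=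
        mul_nonneg (by linarith) (by linarith)
      linarith
    have h3 : a * n * 2 ≤ a * n * ((n : ℝ) - k) := by gcongr; linarith
    linarith
  refine ⟨hpos, fun k hk => ?_, ?_, hlow, fun k hk => ?_⟩
  · rcases Nat.lt_or_ge (k + 1) n with h | h
    · have h1 := hlow k h
      have hk' : (k : ℝ) + 1 ≤ n := by exact_mod_cast hk
      have h2 : 0 ≤ a / 8 * n * ((n : ℝ) - k) := mul_nonneg (by positivity) (by linarith)
      linarith
    · have : k = n - 1 := by omega
      rw [this, max_eq_left hpos.le]
  · have : a * n * 2 ≤ a * n * n := by gcongr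
    nlinarith
  · have h1 := (abs_le.1 (h0 k hk.le)).1
    have hk' : (k : ℝ) + 1 ≤ n := by exact_mod_cast hk
    have hk0 : (0 : ℝ) ≤ k := Nat.cast_nonneg k
    have h2 : a * ((n : ℝ) ^ 2 - (k : ℝ) ^ 2) ≤ a * (2 * (n * ((n : ℝ) - k))) := by
      gcongr
      nlinarith
    have h3 : a * n * 1 ≤ a * n * ((n : ℝ) - k) := by gcongr; linarith
    linarith

theorem eventually_momentBounds {a E : ℝ} (ha : 0 < a) (hE : 0 ≤ E) :
    ∀ᶠ n : ℕ in atTop, ∀ t, NearParabola a E t n → MomentBounds a t n := by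
  have h : Tendsto (fun n : ℕ => √(n : ℝ)) atTop atTop :=
    Real.tendsto_sqrt_atTop.comp tendsto_natCast_atTop_atTop
  filter_upwards [h.eventually_ge_atTop (16 * E / a), eventually_ge_atTop 2] with n hn hn2 t ht
  refine ht.momentBounds ha hE hn2 ?_
  rw [div_le_iff₀ ha] at hn
  calc 16 * (E * √n) = 16 * E * √n := by ring
    _ ≤ √n * a * √n := by gcongr
    _ = a * (√n * √n) := by ring
    _ = a * n := by rw [Real.mul_self_sqrt (Nat.cast_nonneg n)]

/-! ### The front value between two switchings -/

theorem lap_heatKer_le (m : ℤ) {s : ℝ} (hs : 0 ≤ s) {γ : ℝ} (hγ : 0 ≤ γ) :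
    lap heatKer m s ≤ 2 * Real.exp (-γ * ((m : ℝ) - 1) + s * (2 * Real.cosh γ - 2)) := by
  have h1 := heatKer_le_exp γ (m + 1) hs
  have h2 := heatKer_le_exp γ (m - 1) hs
  have h3 := heatKer_nonneg m hs
  have h4 : Real.exp (-γ * ((m + 1 : ℤ) : ℝ) + s * (2 * Real.cosh γ - 2)) ≤
      Real.exp (-γ * ((m : ℝ) - 1) + s * (2 * Real.cosh γ - 2)) := by
    apply Real.exp_le_exp.2
    push_cast
    linarith
  push_cast at h2
  rw [lap]
  linarith

theorem cosh_sub_one_le {γ : ℝ} (h0 : 0 ≤ γ) (h1 : γ ≤ 1) : 2 * Real.cosh γ - 2 ≤ 2 * γ ^ 2 := by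
  have h2 := Real.cosh_le_exp_half_sq γ
  have h3 : Real.exp (γ ^ 2 / 2) ≤ 1 + γ ^ 2 := by
    have h4 := Real.abs_exp_sub_one_le (x := γ ^ 2 / 2) (by
      rw [abs_of_nonneg (by positivity)]; nlinarith)
    rw [abs_of_nonneg (a := γ ^ 2 / 2) (by positivity)] at h4
    linarith [(abs_le.1 h4).2]
  linarith

theorem exists_tail_sum_le {δ : ℝ} (hδ : 0 < δ) : ∃ L : ℕ, 2 ≤ L ∧ ∀ n : ℕ,
    ∑ j ∈ Finset.range n, (if L ≤ j then ((j : ℝ) + 1) ^ (-3 / 2 : ℝ) else 0) ≤ δ := by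
  have hs : Summable fun j : ℕ => ((j : ℝ) + 1) ^ (-3 / 2 : ℝ) := by
    have := (summable_nat_add_iff 1).2
      (Real.summable_nat_rpow.2 (by norm_num : (-3 / 2 : ℝ) < -1))
    simpa using this
  have ht := tendsto_sum_nat_add fun j : ℕ => ((j : ℝ) + 1) ^ (-3 / 2 : ℝ)
  obtain ⟨L, hL, hL2⟩ := ((ht.eventually_le_const hδ).and (eventually_ge_atTop 2)).exists
  refine ⟨L, hL2, fun n => ?_⟩
  rw [← Finset.sum_filter]
  have e : (Finset.range n).filter (fun j => L ≤ j) = Finset.Ico L n := by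
    ext j; simp only [Finset.mem_filter, Finset.mem_range, Finset.mem_Ico]; omega
  rw [e, Finset.sum_Ico_eq_sum_range]
  refine le_trans ?_ hL
  have hs' := (summable_nat_add_iff L).2 hs
  refine le_trans (le_of_eq ?_) (hs'.sum_le_tsum (Finset.range (n - L)) fun j _ => by positivity)
  exact Finset.sum_congr rfl fun j _ => by rw [add_comm L j]

/-- Far away from the source the lattice heat kernel has not yet reached its maximum, but there its
rate of change is exponentially small. -/
theorem lap_heatKer_le_of_far {a γ σ : ℝ} {n L : ℕ} {m : ℤ} (ha : 0 < a) (hγ0 : 0 ≤ γ)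
    (hγ1 : γ ≤ 1) (hγL : 12 * a * L * γ ≤ 1) (hm : n ≤ m) (hσ0 : 0 ≤ σ)
    (hσ : σ ≤ 3 * a * n * L) :
    lap heatKer m σ ≤ 2 * Real.exp γ * Real.exp (-(γ / 2) * n) := by
  refine (lap_heatKer_le m hσ0 hγ0).trans ?_
  rw [mul_assoc, ← Real.exp_add]
  refine mul_le_mul_of_nonneg_left (Real.exp_le_exp.2 ?_) zero_le_two
  have hm' : (n : ℝ) ≤ m := by exact_mod_cast hm
  have h1 : σ * (2 * Real.cosh γ - 2) ≤ 3 * a * n * L * (2 * γ ^ 2) :=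
    mul_le_mul hσ (cosh_sub_one_le hγ0 hγ1) (by linarith [Real.one_le_cosh γ]) (by positivity)
  have h2 : 12 * a * L * γ * (γ * n / 2) ≤ 1 * (γ * n / 2) :=
    mul_le_mul_of_nonneg_right hγL (by positivity)
  have h3 : γ * n ≤ γ * m := mul_le_mul_of_nonneg_left hm' hγ0
  linarith

/-- Convexity of the front value between two switchings, with the last switched node left out: the
sum is negative of order `n^{-3/2}`. The nodes close to the front on the same side contribute
with a favourable sign, the nodes close to the opposite front are exponentially small, and all
others add up to a small multiple of `n^{-3/2}`. -/
theorem eventually_sum_lap_heatKer_nonpos {a E : ℝ} (ha : 0 < a) (hE : 0 ≤ E) :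
    ∀ᶠ n : ℕ in atTop, ∀ t, NearParabola a E t n → ∀ s ∈ Icc (t (n - 1)) (t n),
      ∑ i ∈ Finset.Ioo (-(n : ℤ)) (n - 1), lap heatKer (n - i) (s - max (t i.natAbs) 0) ≤ 0 := by
  obtain ⟨b, C, hb, hC, hneg⟩ := exists_le_neg_lap_heatKer
  obtain ⟨C', hC', habs⟩ := exists_abs_lap_heatKer_le
  -- The term `i = n - 2` is at most `-β n^(-3/2)`. The terms with `n - |i| > L` add up to at most
  -- half of that, and `γ` is chosen for the exponential bound on the remaining terms with `i < 0`.
  set β : ℝ := b / 2 * (6 * a) ^ (-3 / 2 : ℝ) with hβ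
  have hβ0 : 0 < β := by positivity
  set K : ℝ := C' * (a / 8) ^ (-3 / 2 : ℝ) with hK
  have hK0 : 0 < K := by positivity
  obtain ⟨L, hL2, hL⟩ := exists_tail_sum_le (δ := β / (4 * K)) (by positivity)
  have hL0 : (0 : ℝ) < L := by
    have : 0 < L := by omega
    exact_mod_cast this
  set γ : ℝ := min 1 (1 / (12 * a * L)) with hγ
  have hγ0 : 0 < γ := lt_min one_pos (by positivity)
  have hγ1 : γ ≤ 1 := min_le_left _ _
  have hγL : 12 * a * L * γ ≤ 1 := by
    have h : γ ≤ 1 / (12 * a * L) := min_le_right _ _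
    rwa [le_div_iff₀' (by positivity)] at h
  have hlim : Tendsto (fun n : ℕ => (n : ℝ) ^ (3 / 2 : ℝ) * Real.exp (-(γ / 2) * n)) atTop (𝓝 0) :=
    (tendsto_rpow_mul_exp_neg_mul_atTop_nhds_zero _ _ (half_pos hγ0)).comp
      tendsto_natCast_atTop_atTop
  filter_upwards [eventually_momentBounds ha hE, eventually_ge_atTop 2,
    tendsto_natCast_atTop_atTop.eventually_ge_atTop (8 / a),
    tendsto_natCast_atTop_atTop.eventually_ge_atTop (C * L / (b / 2 * (a / 8))),
    hlim.eventually_le_const (by positivity : 0 < β / (8 * L * Real.exp γ))]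
    with n hmb hn2 hna hnC hnω t ht s hs
  have hB := hmb t ht
  have hn0 : (0 : ℝ) < n := by
    have : 0 < n := by omega
    exact_mod_cast this
  set X : ℝ := (n : ℝ) ^ (-3 / 2 : ℝ) with hX
  have hX0 : 0 < X := by positivity
  set ω : ℝ := 2 * Real.exp γ * Real.exp (-(γ / 2) * n) with hω
  have hω0 : 0 < ω := by positivity
  have hωX : 4 * L * ω ≤ β * X := by
    have h1 : (n : ℝ) ^ (3 / 2 : ℝ) * X = 1 := by
      rw [hX, ← Real.rpow_add hn0]; norm_num
    rw [le_div_iff₀ (by positivity)] at hnω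
    have h2 := mul_le_mul_of_nonneg_right hnω hX0.le
    calc 4 * L * ω
        = ((n : ℝ) ^ (3 / 2 : ℝ) * X) * (8 * L * Real.exp γ * Real.exp (-(γ / 2) * n)) := by
          rw [h1, hω]; ring
      _ = (n : ℝ) ^ (3 / 2 : ℝ) * Real.exp (-(γ / 2) * n) * (8 * L * Real.exp γ) * X := by ring
      _ ≤ β * X := h2
  -- Bounds for the terms other than `i = n - 2`, as a function of the distance `j = n - 1 - |i|`.
  set ψ : ℕ → ℝ := fun j => (if L ≤ j then K * X * ((j : ℝ) + 1) ^ (-3 / 2 : ℝ) else 0) +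
    (if j < L then ω else 0) with hψ
  have hψ0 : ∀ j, 0 ≤ ψ j := fun j => by
    simp only [hψ]; split_ifs <;> positivity
  have hnear : ∀ i : ℤ, 0 ≤ i → i + 2 ≤ n → (n - i : ℤ) ≤ L →
      lap heatKer (n - i) (s - max (t i.natAbs) 0) ≤
        -(b / 2 * (s - max (t i.natAbs) 0) ^ (-3 / 2 : ℝ)) := by
    intro i hi0 hin hiL
    set σ : ℝ := s - max (t i.natAbs) 0 with hσ
    have e : (i.natAbs : ℝ) = i := by
      rw [Nat.cast_natAbs, Int.cast_abs, abs_of_nonneg (by exact_mod_cast hi0)]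
    have hlow : a / 8 * n * ((n : ℝ) - i) ≤ σ := by
      have := hB.lower i.natAbs (by omega)
      rw [e] at this
      linarith [hs.1]
    have hmL : (n : ℝ) - i ≤ L := by exact_mod_cast hiL
    have hm2 : (2 : ℝ) ≤ (n : ℝ) - i := by
      have : (i : ℝ) + 2 ≤ n := by exact_mod_cast hin
      linarith
    have han : 1 ≤ a / 8 * n := by rw [div_le_iff₀ ha] at hna; linarith
    have hσ1 : 1 ≤ σ := by nlinarith
    have hσ0 : 0 < σ := by linarith
    have h := hneg (n - i) σ hσ1
    have hpow : σ ^ (-5 / 2 : ℝ) = σ ^ (-3 / 2 : ℝ) / σ := by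
      rw [show (-5 / 2 : ℝ) = -3 / 2 - 1 by norm_num, Real.rpow_sub_one hσ0.ne']
    have hP : 0 < σ ^ (-3 / 2 : ℝ) := by positivity
    have hq : C * (((n - i : ℤ) : ℝ)) ^ 2 ≤ b / 2 * σ := by
      rw [div_le_iff₀ (by positivity)] at hnC
      push_cast
      calc C * ((n : ℝ) - i) ^ 2 = C * ((n : ℝ) - i) * ((n : ℝ) - i) := by ring
        _ ≤ C * L * ((n : ℝ) - i) := by gcongr
        _ ≤ n * (b / 2 * (a / 8)) * ((n : ℝ) - i) := by gcongr
        _ = b / 2 * (a / 8 * n * ((n : ℝ) - i)) := by ring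
        _ ≤ b / 2 * σ := by gcongr
    have hq' : C * (((n - i : ℤ) : ℝ)) ^ 2 * σ ^ (-5 / 2 : ℝ) ≤ b / 2 * σ ^ (-3 / 2 : ℝ) := by
      rw [hpow, ← mul_div_assoc, div_le_iff₀ hσ0]
      calc C * (((n - i : ℤ) : ℝ)) ^ 2 * σ ^ (-3 / 2 : ℝ) ≤ b / 2 * σ * σ ^ (-3 / 2 : ℝ) := by
            gcongr
        _ = _ := by ring
    linarith
  have hpt : ∀ i ∈ Finset.Ioo (-(n : ℤ)) (n - 1), lap heatKer (n - i) (s - max (t i.natAbs) 0) ≤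
      (if i = n - 2 then -(β * X) else 0) + ψ (n - 1 - i.natAbs) := by
    intro i hi
    rw [Finset.mem_Ioo] at hi
    set σ : ℝ := s - max (t i.natAbs) 0 with hσ
    have hin : i.natAbs < n := by omega
    set j : ℕ := n - 1 - i.natAbs with hj
    have hjl : (j : ℝ) + 1 = (n : ℝ) - i.natAbs := by
      have : j + 1 + i.natAbs = n := by omega
      have : (j : ℝ) + 1 + i.natAbs = n := by exact_mod_cast this
      linarith
    have hσ0 : 0 ≤ σ := by linarith [hB.max_le i.natAbs hin, hs.1]
    have hup : σ ≤ 3 * a * n * ((j : ℝ) + 1) := by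
      rw [hjl]; linarith [hB.upper i.natAbs hin, hs.2]
    by_cases hi2 : i = n - 2
    · -- The most recently switched node that is kept in the sum.
      rw [if_pos hi2]
      have h1 := hnear i (by omega) (by omega) (by omega)
      have hj1 : (j : ℝ) = 1 := by
        have : j = 1 := by omega
        rw [this]; simp
      have hlow := hB.lower i.natAbs (by omega)
      have hσpos : 0 < σ := by
        have : 0 < a / 8 * n * ((n : ℝ) - i.natAbs) := by rw [← hjl]; positivity
        linarith [hs.1]
      have h2 : (6 * a) ^ (-3 / 2 : ℝ) * X ≤ σ ^ (-3 / 2 : ℝ) := by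
        rw [hX, ← Real.mul_rpow (by positivity) hn0.le]
        refine Real.rpow_le_rpow_of_nonpos hσpos ?_ (by norm_num)
        rw [hj1] at hup
        linarith
      have h3 : β * X ≤ b / 2 * σ ^ (-3 / 2 : ℝ) := by
        rw [hβ, mul_assoc]; gcongr
      linarith [hψ0 j]
    · rw [if_neg hi2, zero_add]
      rcases le_or_gt L j with hLj | hLj
      · simp only [hψ, if_pos hLj, if_neg (not_lt.2 hLj), add_zero]
        have hlow : a / 8 * n * ((j : ℝ) + 1) ≤ σ := by
          rw [hjl]; linarith [hB.lower i.natAbs (by omega), hs.1]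
        have hσpos : 0 < σ := lt_of_lt_of_le (by positivity) hlow
        refine (le_abs_self _).trans ((habs _ σ hσpos).trans ?_)
        rw [hK, hX, mul_assoc, mul_assoc, ← mul_assoc ((a / 8) ^ (-3 / 2 : ℝ)),
          ← Real.mul_rpow (by positivity) hn0.le, ← Real.mul_rpow (by positivity) (by positivity)]
        refine mul_le_mul_of_nonneg_left ?_ hC'.le
        exact Real.rpow_le_rpow_of_nonpos (by positivity) hlow (by norm_num)
      · simp only [hψ, if_neg (not_le.2 hLj), if_pos hLj, zero_add]
        rcases le_or_gt 0 i with hi0 | hi0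
        · refine (hnear i hi0 (by omega) (by omega)).trans ?_
          have : 0 ≤ σ ^ (-3 / 2 : ℝ) := by positivity
          have : 0 ≤ b / 2 * σ ^ (-3 / 2 : ℝ) := by positivity
          linarith
        · refine lap_heatKer_le_of_far ha hγ0.le hγ1 hγL (by omega) hσ0 (hup.trans ?_)
          have : (j : ℝ) + 1 ≤ L := by exact_mod_cast hLj
          gcongr
  refine (Finset.sum_le_sum hpt).trans ?_
  rw [Finset.sum_add_distrib, Finset.sum_ite_eq' (Finset.Ioo (-(n : ℤ)) (n - 1)) ((n : ℤ) - 2),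
    if_pos (by rw [Finset.mem_Ioo]; omega)]
  have h1 : ∑ i ∈ Finset.Ioo (-(n : ℤ)) (n - 1), ψ (n - 1 - i.natAbs) ≤
      2 * ∑ j ∈ Finset.range n, ψ j := by
    rw [← Finset.sum_range_reflect]
    refine le_trans ?_ (sum_natAbs_le n (f := fun k => ψ (n - 1 - k)) fun k _ => hψ0 _)
    exact Finset.sum_le_sum_of_subset_of_nonneg
      (Finset.Ioo_subset_Ioo_right (by omega)) fun i _ _ => hψ0 _
  have h2 : ∑ j ∈ Finset.range n, ψ j ≤ K * X * (β / (4 * K)) + L * ω := by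
    simp only [hψ]
    rw [Finset.sum_add_distrib]
    refine add_le_add ?_ ?_
    · refine le_trans (le_of_eq ?_) (mul_le_mul_of_nonneg_left (hL n) (by positivity : 0 ≤ K * X))
      rw [Finset.mul_sum]
      exact Finset.sum_congr rfl fun j _ => by rw [mul_ite, mul_zero]
    · rw [← Finset.sum_filter, Finset.sum_const, nsmul_eq_mul]
      refine mul_le_mul_of_nonneg_right ?_ hω0.le
      have : (Finset.range n).filter (fun j => j < L) ⊆ Finset.range L := fun j hj =>
        Finset.mem_range.2 (Finset.mem_filter.1 hj).2
      exact_mod_cast (Finset.card_le_card this).trans (Finset.card_range L).le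
  have h3 : K * X * (β / (4 * K)) = β * X / 4 := by field_simp
  rw [h3] at h2
  linarith

/-- Between two consecutive switchings the value at the front hardly exceeds zero: it is a convex
function minus the response to the node switched last, and the latter is almost above its
chord. -/
theorem eventually_model_front_le {h₁ c a E δ : ℝ} (hh : 0 < h₁) (ha : 0 < a) (hE : 0 ≤ E)
    (hδ : 0 < δ) : ∀ᶠ n : ℕ in atTop, ∀ t, NearParabola a E t n →
      model h₁ c t n n (t (n - 1)) ≤ 0 → model h₁ c t n n (t n) = 0 →
      ∀ s ∈ Icc (t (n - 1)) (t n), model h₁ c t n n s ≤ δ := by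
  obtain ⟨D, hD, hchord⟩ := exists_chord_le_latticeGreen_one (ε := δ / h₁) (by positivity)
  filter_upwards [eventually_momentBounds ha hE, eventually_sum_lap_heatKer_nonpos ha hE,
    eventually_ge_atTop 2, tendsto_natCast_atTop_atTop.eventually_ge_atTop (D / a)]
    with n hmb hlap hn2 hnD t ht hleft hright s hs
  have hB := hmb t ht
  set p : ℝ := t (n - 1) with hp
  set q : ℝ := t n with hq
  have hΔ : D ≤ q - p := by
    rw [div_le_iff₀ ha] at hnD
    linarith [hB.gap]
  have hΔ0 : 0 < q - p := by linarith
  set S := Finset.Ioo (-(n : ℤ)) (n - 1) with hS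
  have hSsplit : Finset.Ioo (-(n : ℤ)) n = insert ((n : ℤ) - 1) S := by
    ext i; simp only [hS, Finset.mem_insert, Finset.mem_Ioo]; omega
  have hnotin : ((n : ℤ) - 1) ∉ S := by simp [hS]
  have hτ : ∀ i ∈ S, max (t i.natAbs) 0 ≤ p := fun i hi =>
    hB.max_le _ (by rw [hS, Finset.mem_Ioo] at hi; omega)
  -- The value at the front without the contribution of the last switched node.
  set A : ℝ → ℝ := fun s => -c * ((n : ℤ) : ℝ) ^ 2 + (h₁ - 2 * c) * s -
    h₁ * ∑ i ∈ S, latticeGreen (n - i) (s - max (t i.natAbs) 0) with hA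
  have hAmodel : ∀ s, model h₁ c t n n s = A s - h₁ * latticeGreen 1 (s - p) := by
    intro s
    have e1 : ((n : ℤ) - 1).natAbs = n - 1 := by omega
    have e2 : (n : ℤ) - ((n : ℤ) - 1) = 1 := by ring
    simp only [model, hA]
    rw [hSsplit, Finset.sum_insert hnotin, e1, e2, ← hp, max_eq_left hB.pos.le]
    ring
  have hconv : ConvexOn ℝ (Icc p q) A := by
    refine convexOn_of_hasDerivWithinAt2_nonneg (convex_Icc p q)
      (f' := fun s => (h₁ - 2 * c) * 1 -
        h₁ * ∑ i ∈ S, heatKer (n - i) (s - max (t i.natAbs) 0))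
      (f'' := fun s => -(h₁ * ∑ i ∈ S, lap heatKer (n - i) (s - max (t i.natAbs) 0))) ?_ ?_ ?_ ?_
    · have := continuous_latticeGreen
      apply Continuous.continuousOn
      fun_prop
    · intro s hs
      rw [interior_Icc] at hs
      have h1 : ∀ i ∈ S, HasDerivAt (fun s => latticeGreen (n - i) (s - max (t i.natAbs) 0))
          (heatKer (n - i) (s - max (t i.natAbs) 0)) s := by
        intro i hi
        have := (hasDerivAt_latticeGreen (n - i) (s := s - max (t i.natAbs) 0)
          (by linarith [hτ i hi, hs.1])).comp s ((hasDerivAt_id s).sub_const _)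
        exact this.congr_deriv (mul_one _)
      have h2 : HasDerivAt (fun s : ℝ => -c * ((n : ℤ) : ℝ) ^ 2 + (h₁ - 2 * c) * s)
          ((h₁ - 2 * c) * 1) s := ((hasDerivAt_id s).const_mul _).const_add _
      exact (h2.sub ((HasDerivAt.fun_sum h1).const_mul h₁)).hasDerivWithinAt
    · intro s _
      have h1 : ∀ i ∈ S, HasDerivAt (fun s => heatKer (n - i) (s - max (t i.natAbs) 0))
          (lap heatKer (n - i) (s - max (t i.natAbs) 0)) s := by
        intro i _
        have := (hasDerivAt_heatKer (n - i) (s - max (t i.natAbs) 0)).comp s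
          ((hasDerivAt_id s).sub_const _)
        exact this.congr_deriv (mul_one _)
      exact (((HasDerivAt.fun_sum h1).const_mul h₁).const_sub _).hasDerivWithinAt
    · intro s hs
      have := hlap t ht s (interior_subset hs)
      exact neg_nonneg.2 (mul_nonpos_of_nonneg_of_nonpos hh.le this)
  have hAp : A p ≤ 0 := by
    have := hAmodel p
    rw [sub_self, latticeGreen_of_nonpos 1 le_rfl, mul_zero, sub_zero] at this
    rwa [← this]
  have hAq : A q = h₁ * latticeGreen 1 (q - p) := by
    have := hAmodel q
    rw [hright] at this
    linarith
  set lam : ℝ := (s - p) / (q - p) with hlam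
  have hlam0 : 0 ≤ lam := div_nonneg (by linarith [hs.1]) hΔ0.le
  have hlam1 : lam ≤ 1 := by rw [hlam, div_le_one hΔ0]; linarith [hs.2]
  have hc := hconv.2 (left_mem_Icc.2 (by linarith)) (right_mem_Icc.2 (by linarith))
    (sub_nonneg.2 hlam1) hlam0 (by ring)
  have hpt : (1 - lam) • p + lam • q = s := by
    simp only [smul_eq_mul, hlam]; field_simp; ring
  rw [hpt] at hc
  simp only [smul_eq_mul] at hc
  have h1 : (1 - lam) * A p ≤ 0 := mul_nonpos_of_nonneg_of_nonpos (sub_nonneg.2 hlam1) hAp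
  have h2 := hchord (q - p) hΔ (s - p) ⟨by linarith [hs.1], by linarith [hs.2]⟩
  have h3 := mul_le_mul_of_nonneg_left h2 hh.le
  rw [mul_div_cancel₀ δ hh.ne', mul_sub] at h3
  rw [hAmodel]
  rw [hAq] at hc
  have h4 : h₁ * (lam * latticeGreen 1 (q - p)) = lam * (h₁ * latticeGreen 1 (q - p)) := by ring
  linarith

/-- At the moment `t_{n-1}` the node `n - 1` has not yet influenced the slope at the front. -/
theorem grad_model_pred (h₁ c : ℝ) (t : ℕ → ℝ) {n : ℕ} (hn : 1 ≤ n) :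
    grad (model h₁ c t n) ((n : ℤ) - 1) (t (n - 1)) =
      grad (model h₁ c t (n - 1)) ((n - 1 : ℕ) : ℤ) (t (n - 1)) := by
  have e : ((n - 1 : ℕ) : ℤ) = (n : ℤ) - 1 := by omega
  rw [grad_model, grad_model, e]
  congr 2
  refine (Finset.sum_subset (Finset.Ioo_subset_Ioo (by omega) (by omega)) fun i hi hi' => ?_).symm
  rw [Finset.mem_Ioo] at hi hi'
  have : i.natAbs = n - 1 := by omega
  rw [this]
  exact latticeTail_of_nonpos _ (sub_nonpos.2 (le_max_left _ _))

/-- Ahead of the front the explicit solution is decreasing in space and negative, uniformly over all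
admissible sequences of moments. -/
theorem eventually_model_front {h₁ c a E : ℝ} (hc : 0 < c) (hh : 0 < h₁) (ha : 0 < a)
    (hroot : leadingCoeff (h₁ / c) a = 0) (hE : 0 ≤ E) :
    ∀ᶠ n : ℕ in atTop, ∀ t, NearParabola a E t n →
      model h₁ c t n ((n : ℤ) - 1) (t (n - 1)) = 0 → model h₁ c t n n (t n) = 0 →
      ∀ s ∈ Ioc (t (n - 1)) (t n), (∀ j : ℤ, n ≤ j → grad (model h₁ c t n) j s < 0) ∧
        ∀ j : ℤ, n + 1 ≤ j → model h₁ c t n j s < 0 := by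
  have hgrad := eventually_grad_model_le hc hh ha hroot hE
  filter_upwards [hgrad, (tendsto_sub_atTop_nat 1).eventually hgrad,
    eventually_model_front_le (c := c) hh ha hE (half_pos (half_pos hc)), eventually_ge_atTop 1]
    with n h1 h2 h3 hn t ht hpred hfront s hs
  have hg : ∀ j : ℤ, n ≤ j → grad (model h₁ c t n) j s ≤ -(c / 2) := fun j hj =>
    (grad_model_anti hh.le hc.le t n hj s).trans
      ((grad_model_mono hh.le t n le_rfl hs.2).trans (h1 t ht))
  -- At time `t (n - 1)` the front value is controlled by the slope at the previous front.
  have hleft : model h₁ c t n n (t (n - 1)) ≤ 0 := by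
    have h4 := h2 t (ht.mono (Nat.sub_le n 1))
    rw [← grad_model_pred h₁ c t hn, grad, hpred, sub_add_cancel] at h4
    linarith
  have hs' := h3 t ht hleft hfront s (Ioc_subset_Icc_self hs)
  refine ⟨fun j hj => lt_of_le_of_lt (hg j hj) (by linarith), fun j hj => ?_⟩
  induction j, hj using Int.leInduction with
  | base =>
    have := hg n le_rfl
    rw [grad] at this
    linarith
  | succ j hj ih =>
    have := hg j (by omega)
    rw [grad] at this
    linarith

/-! ### Hysteresis outputs and prescribed outputs -/

/-- A solution of the hysteresis problem is even in `k`. -/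
theorem IsHysteresisSolution.even {h₁ c : ℝ} (hc : 0 < c) (hh : 0 ≤ h₁) {u : ℤ → ℝ → ℝ}
    (hu : IsHysteresisSolution h₁ c u) (k : ℤ) {s : ℝ} (hs : 0 ≤ s) :
    u k s = u k.natAbs s := by
  rcases Int.natAbs_eq k with h | h
  · rw [← h]
  · have h1 := hu.unique hc hh hu.reflect k hs
    rw [h1, h, neg_neg, Int.natAbs_neg, Int.natAbs_natCast]

/-- Until the moment `τ`, the outputs of the hysteresis operators are the prescribed ones, provided
that the nodes `k < n` switch at the prescribed moments and the nodes `k ≥ n` stay negative. -/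
theorem IsHysteresisSolution.hysteresis_eq_prescribedOutput {h₁ c : ℝ} (hc : 0 < c) (hh : 0 ≤ h₁)
    {u : ℤ → ℝ → ℝ} (hu : IsHysteresisSolution h₁ c u) {t : ℕ → ℝ} {n : ℕ} {τ : ℝ}
    (hswitch : ∀ k < n, IsSwitchingMoment (u k) (t k))
    (hneg : ∀ j : ℤ, n ≤ j → ∀ s ∈ Icc 0 τ, u j s < 0) (k : ℤ) {s : ℝ} (hs : s ∈ Icc 0 τ) :
    hysteresis h₁ (u k) s = prescribedOutput h₁ t n k s := by
  rw [hysteresis_congr fun r hr => hu.even hc hh k hr.1, prescribedOutput]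
  by_cases hk : k.natAbs < n
  · simp only [hk, true_and, (hswitch _ hk).hysteresis_eq]
  · rw [if_neg fun h => hk h.1]
    exact hysteresis_of_neg fun r hr => hneg _ (by omega) r ⟨hr.1, hr.2.trans hs.2⟩

end Rattling

theorem mainTheorem6 (h₁ c : ℝ) (hc : 0 < c) (hh : 2 * c < h₁)
    (a : ℝ) (ha : 0 < a) (hroot : Rattling.leadingCoeff (h₁ / c) a = 0)
    (E : ℝ) (hE : 0 < E) :
    ∃ n₀ : ℕ, ∀ n : ℕ, n₀ + 1 ≤ n → ∀ t : ℕ → ℝ,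
      (∀ k ≤ n, |t k - a * (k : ℝ) ^ 2| ≤ E * Real.sqrt k) →
      -- the solution of the hysteresis problem and the frozen problem
      (∀ u v : ℤ → ℝ → ℝ,
        Rattling.IsHysteresisSolution h₁ c u →
        (∀ k < n, Rattling.IsSwitchingMoment (u k) (t k)) →
        (∀ j : ℤ, n ≤ j → ∀ s ∈ Set.Icc 0 (t (n - 1)), u j s < 0) →
        Rattling.IsFrozenSolution h₁ u (t (n - 1)) v →
        v n (t n) = 0 →
        (∀ s ∈ Set.Ioc (t (n - 1)) (t n), ∀ j : ℤ, n ≤ j → Rattling.grad v j s < 0) ∧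
        (∀ s ∈ Set.Ioc (t (n - 1)) (t n), ∀ j : ℤ, n + 1 ≤ j → v j s < 0) ∧
        (∀ j : ℤ, n + 1 ≤ j → ∀ s, Rattling.IsSwitchingMoment (u j) s → t n < s)) ∧
      -- the same `n₀` serves all admissible sequences of moments, whether or not they come from
      -- the hysteresis operator
      (∀ w : ℤ → ℝ → ℝ,
        Rattling.IsLatticeSolution (Rattling.prescribedOutput h₁ t n) 0 w →
        (∀ k : ℤ, w k 0 = -c * (k : ℝ) ^ 2) →
        w (n - 1) (t (n - 1)) = 0 →
        w n (t n) = 0 →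
        (∀ s ∈ Set.Ioc (t (n - 1)) (t n), ∀ j : ℤ, n ≤ j → Rattling.grad w j s < 0) ∧
        (∀ s ∈ Set.Ioc (t (n - 1)) (t n), ∀ j : ℤ, n + 1 ≤ j → w j s < 0)) := by
  have hh₁ : 0 < h₁ := by linarith
  obtain ⟨n₀, hn₀⟩ := Filter.eventually_atTop.1 ((Rattling.eventually_momentBounds ha hE.le).and
    (Rattling.eventually_model_front hc hh₁ ha hroot hE.le))
  refine ⟨n₀, fun n hn t ht => ?_⟩
  obtain ⟨hB, hfront⟩ := hn₀ n (by omega)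
  replace hB := hB t ht
  replace hfront := hfront t ht
  have hτ0 : 0 < t (n - 1) := hB.pos
  have hn0 : 0 < n := by omega
  have hτ : t (n - 1) ≤ t n := by
    have := hB.gap
    have : 0 ≤ a * n := by positivity
    linarith
  have hmodel := Rattling.isLatticeSolution_model h₁ c t n
  refine ⟨fun u v hu hswitch hneg hv hvn => ?_, fun w hw hw0 hpred hwn => ?_⟩
  · have huout : ∀ k : ℤ, ∀ s ∈ Icc 0 (t (n - 1)),
        Rattling.hysteresis h₁ (u k) s = Rattling.prescribedOutput h₁ t n k s := fun k s hs =>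
      hu.hysteresis_eq_prescribedOutput hc hh₁.le hswitch hneg k hs
    have hum : ∀ k, ∀ s ∈ Icc 0 (t (n - 1)), u k s = Rattling.model h₁ c t n k s :=
      hu.1.eq_of_eq hmodel le_rfl le_rfl
        (fun k => by rw [hu.2 k, Rattling.model_zero])
        fun k s hs => huout k s (Ico_subset_Icc_self hs)
    -- All nodes `|k| < n` have switched by the time `t (n - 1)`, so the prescribed output is
    -- constant from then on.
    have hconst : ∀ k : ℤ, ∀ s, t (n - 1) ≤ s → Rattling.prescribedOutput h₁ t n k (t (n - 1)) =
        Rattling.prescribedOutput h₁ t n k s := fun k s hs => by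
      by_cases hk : k.natAbs < n
      · have := (le_max_left _ _).trans (hB.max_le _ hk)
        simp [Rattling.prescribedOutput, hk, this, this.trans hs]
      · simp [Rattling.prescribedOutput, hk]
    have hvm : ∀ k, ∀ s ∈ Icc (t (n - 1)) (t n), v k s = Rattling.model h₁ c t n k s :=
      hv.1.eq_of_eq hmodel le_rfl hτ0.le
        (fun k => by rw [hv.2 k, hum k _ ⟨hτ0.le, le_rfl⟩])
        fun k s hs => by rw [huout k _ ⟨hτ0.le, le_rfl⟩, hconst k s hs.1]
    have hpred : Rattling.model h₁ c t n ((n : ℤ) - 1) (t (n - 1)) = 0 := by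
      rw [← hum _ _ ⟨hτ0.le, le_rfl⟩]
      have := (hswitch (n - 1) (by omega)).2.1
      rwa [Nat.cast_sub (by omega), Nat.cast_one] at this
    have key := hfront hpred (by rw [← hvm _ _ ⟨hτ, le_rfl⟩, hvn])
    have hvneg : ∀ s ∈ Ioc (t (n - 1)) (t n), ∀ j : ℤ, n + 1 ≤ j → v j s < 0 :=
      fun s hs j hj => by
        rw [hvm j s (Ioc_subset_Icc_self hs)]
        exact (key s hs).2 j hj
    refine ⟨fun s hs j hj => ?_, hvneg, fun j hj s hsw => ?_⟩
    · have := (key s hs).1 j hj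
      rwa [Rattling.grad, ← hvm _ s (Ioc_subset_Icc_self hs),
        ← hvm _ s (Ioc_subset_Icc_self hs)] at this
    · -- The output only decreases in time, so the frozen solution is an upper bound for `u`.
      have huv : ∀ k, ∀ s ∈ Icc (t (n - 1)) (t n), u k s ≤ v k s :=
        hu.1.le_of_le hv.1 hτ0.le le_rfl (fun k => (hv.2 k).ge)
          fun k s hs => Rattling.hysteresis_anti hh₁.le _ hs.1
      by_contra! hsn
      rcases le_or_gt s (t (n - 1)) with h | h
      · exact (hneg j (by omega) s ⟨hsw.1, h⟩).ne hsw.2.1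
      · exact ((huv j s ⟨h.le, hsn⟩).trans_lt (hvneg s ⟨h, hsn⟩ j hj)).ne hsw.2.1
  · have hwm : ∀ k, ∀ s ∈ Icc 0 (t n), w k s = Rattling.model h₁ c t n k s :=
      hw.eq_of_eq hmodel le_rfl le_rfl
        (fun k => by rw [hw0 k, Rattling.model_zero]) fun _ _ _ => rfl
    have key := hfront (by rw [← hwm _ _ ⟨hτ0.le, hτ⟩, hpred])
      (by rw [← hwm _ _ ⟨hτ0.le.trans hτ, le_rfl⟩, hwn])
    have hmem : ∀ s ∈ Ioc (t (n - 1)) (t n), s ∈ Icc 0 (t n) := fun s hs =>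
      ⟨hτ0.le.trans hs.1.le, hs.2⟩
    refine ⟨fun s hs j hj => ?_, fun s hs j hj => ?_⟩
    · have := (key s hs).1 j hj
      rwa [Rattling.grad, ← hwm _ s (hmem s hs), ← hwm _ s (hmem s hs)] at this
    · rw [hwm j s (hmem s hs)]
      exact (key s hs).2 j hj
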